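/- Let $k\ge 0$ be an integer and let $\Pi$ be a finite collection of predicates $P:\{0,1\}^k\to\{0,1\}$. A \emph{constraint} on $n$ variables is a function $x\mapsto P(x_{i_1},\dots,x_{i_k})$ on $\{0,1\}^n$ with $P\in\Pi$ and distinct $i_1,\dots,i_k\in[n]$. An \emph{instance} $\Im$ of $\mathrm{max}\text{-}\Pi_n$ is a nonempty finite list of constraints $P_1,\dots,P_M$ on $n$ variables; we write $\Im(x)=\frac1M\sum_{i=1}^M P_i(x)$ and $\mathrm{opt}(\Im)=\max_{x\in\{0,1\}^n}\Im(x)$. For $f:\{0,1\}^n\to\mathbb R$ let $\overline{\mathrm{sos}}_d(f)$ be the smallest $v\in\mathbb R$ such that $v-f=\sum_{j=1}^t g_j^2$ on $\{0,1\}^n$ for some $t$ and some functions $g_j:\{0,1\}^n\to\mathbb R$ of degree at most $d/2$ (as multilinear polynomials), with $\overline{\mathrm{sos}}_d(f)=\infty$ if there is no such $v$. The \emph{degree-$d$ sos relaxation achieves a $(c,s)$-approximation for $\mathrm{max}\text{-}\Pi_n$} if $\overline{\mathrm{sos}}_d(\Im)\le c$ for every instance $\Im$ of $\mathrm{max}\text{-}\Pi_n$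 with $\mathrm{opt}(\Im)\le s$. An \emph{SDP relaxation of size $r$ for $\mathrm{max}\text{-}\Pi_n$} consists of matrices $\tilde\Im\in\mathbb R^{r\times r}$ for all instances $\Im$ of $\mathrm{max}\text{-}\Pi_n$ and $\tilde x\in\mathbb R^{r\times r}$ for all $x\in\{0,1\}^n$ with $\langle\tilde\Im,\tilde x\rangle=\mathrm{Tr}(\tilde\Im^{T}\tilde x)=\Im(x)$, and a spectrahedron $\mathcal S=\{y\in\mathbb R^{r\times r}: y\succeq 0,\ Ay=b\}$, where $A$ is a linear map and $b$ a vector (both independent of $\Im$), such that $\tilde x\in\mathcal S$ for all $x$. It \emph{achieves a $(c,s)$-approximation} if $\sup_{y\in\mathcal S}\langle\tilde\Im,y\rangle\le c$ for every instance $\Im$ of $\mathrm{max}\text{-}\Pi_n$ with $\mathrm{opt}(\Im)\le s$. **Theorem.** Let $d:\{1,2,\dots\}\to\mathbb N$ be monotone increasing (that is, nondecreasing) with $d(1)\ge 2\lceil k/2\rceil$ and $\lim_{n\to\infty}d(n)=\infty$. Let $\varepsilon>0$ and $0<s<c\le 1$. Then there is a constant $K>0$ (depending only on $\Pi,d,\varepsilon,c,s$)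 such that the following holds for every $n\ge 1$: if the degree-$d(n)$ sos relaxation does not achieve a $(c+\varepsilon,s)$-approximation for $\mathrm{max}\text{-}\Pi_n$, then for every $N>n^{4d(n)}$ no SDP relaxation of size at most $K\,n^{d(n)^2/8}$ achieves a $(c,s)$-approximation for $\mathrm{max}\text{-}\Pi_N$. -/

import Mathlib

/-- The discrete cube `{0,1}^n`. -/
abbrev Cube (n : ℕ) : Type := Fin n → Bool

/-- The real value of a bit. -/
def bitVal (b : Bool) : ℝ := if b then 1 else 0

/-- The function `f` on the cube has degree at most `e`: the multilinear polynomial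
`∑ A, a A * ∏ i ∈ A, x i` that agrees with `f` on the cube only has monomials with `|A| ≤ e`. -/
def DegreeLE {n : ℕ} (f : Cube n → ℝ) (e : ℕ) : Prop :=
  ∃ a : Finset (Fin n) → ℝ, (∀ A, e < A.card → a A = 0) ∧
    ∀ x, f x = ∑ A, a A * ∏ i ∈ A, bitVal (x i)

/-- `f` is a sum of squares of functions of degree at most `d / 2`
(degrees are integers, so the rounding in `d / 2` is harmless). -/
def IsCubeSOS {n : ℕ} (d : ℕ) (f : Cube n → ℝ) : Prop :=
  ∃ (t : ℕ) (g : Fin t → Cube n → ℝ), (∀ j, DegreeLE (g j) (d / 2)) ∧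
    ∀ x, f x = ∑ j, g j x ^ 2

/-- The degree-`d` sum-of-squares upper bound: the least `v` such that `v - f` is a sum of squares
of functions of degree at most `d / 2` (`⊤` if there is no such `v`). -/
noncomputable def sosBound {n : ℕ} (d : ℕ) (f : Cube n → ℝ) : EReal :=
  sInf {v : EReal | ∃ c : ℝ, v = (c : EReal) ∧ IsCubeSOS d (fun x => c - f x)}

/-- A `k`-ary boolean CSP: a finite collection of predicates `{0,1}^k → {0,1}`. -/
abbrev BoolCSP (k : ℕ) : Type := Finset (Cube k → Bool)

/-- A constraint over `n` variables: a predicate of the CSP applied to distinct variables. -/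
structure CSPConstraint {k : ℕ} (P : BoolCSP k) (n : ℕ) where
  pred : Cube k → Bool
  pred_mem : pred ∈ P
  vars : Fin k ↪ Fin n

/-- The `0/1` value of a constraint under an assignment. -/
def CSPConstraint.value {k n : ℕ} {P : BoolCSP k} (C : CSPConstraint P n) (x : Cube n) : ℝ :=
  bitVal (C.pred (fun j => x (C.vars j)))

/-- An instance on `n` variables: a nonempty finite family of constraints. -/
structure CSPInstance {k : ℕ} (P : BoolCSP k) (n : ℕ) where
  size : ℕ
  size_pos : 0 < size
  constraint : Fin size → CSPConstraint P n

/-- The fraction of constraints satisfied by an assignment. -/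
noncomputable def CSPInstance.value {k n : ℕ} {P : BoolCSP k} (I : CSPInstance P n)
    (x : Cube n) : ℝ :=
  (1 / (I.size : ℝ)) * ∑ j, (I.constraint j).value x

/-- The optimal value of an instance. -/
noncomputable def CSPInstance.opt {k n : ℕ} {P : BoolCSP k} (I : CSPInstance P n) : ℝ :=
  Finset.univ.sup' Finset.univ_nonempty I.value

/-- The degree-`d` sos relaxation achieves a `(c, s)`-approximation on `n`-variable instances. -/
def SosAchieves {k : ℕ} (P : BoolCSP k) (n d : ℕ) (c s : ℝ) : Prop :=
  ∀ I : CSPInstance P n, I.opt ≤ s → sosBound d I.value ≤ (c : EReal)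

/-- The trace inner product on `r × r` matrices. -/
def frobInner {r : ℕ} (A B : Matrix (Fin r) (Fin r) ℝ) : ℝ := (A.transpose * B).trace

/-- An SDP relaxation of size `r` for the `n`-variable instances of a CSP: a linearization of
instances and assignments, and a spectrahedron `{y ⪰ 0 | A y = b}` that contains the linearized
assignments and does not depend on the instance. -/
structure SDPRelaxation {k : ℕ} (P : BoolCSP k) (n r : ℕ) where
  linInstance : CSPInstance P n → Matrix (Fin r) (Fin r) ℝ
  linAssignment : Cube n → Matrix (Fin r) (Fin r) ℝ
  inner_eq : ∀ I x, frobInner (linInstance I) (linAssignment x) = I.value x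
  numEqs : ℕ
  A : Matrix (Fin r) (Fin r) ℝ →ₗ[ℝ] (Fin numEqs → ℝ)
  b : Fin numEqs → ℝ
  posSemidef_assignment : ∀ x, (linAssignment x).PosSemidef
  map_assignment : ∀ x, A (linAssignment x) = b

/-- The feasible spectrahedron of a relaxation. -/
def SDPRelaxation.feasible {k n r : ℕ} {P : BoolCSP k} (R : SDPRelaxation P n r) :
    Set (Matrix (Fin r) (Fin r) ℝ) :=
  {y | y.PosSemidef ∧ R.A y = R.b}

/-- The value of a relaxation on an instance: the supremum of the linearized objective over the
feasible region (`⊤` if unbounded). -/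
noncomputable def SDPRelaxation.value {k n r : ℕ} {P : BoolCSP k} (R : SDPRelaxation P n r)
    (I : CSPInstance P n) : EReal :=
  ⨆ y ∈ R.feasible, ((frobInner (R.linInstance I) y : ℝ) : EReal)

/-- The relaxation achieves a `(c, s)`-approximation on `n`-variable instances. -/
def SDPRelaxation.Achieves {k n r : ℕ} {P : BoolCSP k} (R : SDPRelaxation P n r)
    (c s : ℝ) : Prop :=
  ∀ I : CSPInstance P n, I.opt ≤ s → R.value I ≤ (c : EReal)

/-! Suppose the sos bound of an instance I with `I.opt ≤ s` exceeds c + ε. Convex separation gives a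
pseudo-density D on {0,1}^n: a function of mean 1, bounded by B = (n+1)^d, that correlates
nonnegatively with squares of functions of degree at most d/2, while D · (c - I) has mean at most -ε
(`exists_pseudoDensity`).

Arrange n·q of the N variables in n blocks of size q = n^(4d-1). For each S : [n] → [q], plant I on
the graph of S, which takes one variable from each block; let x_S be the restriction of x to that
graph. A relaxation of size r achieving (c, s) yields, by approximate duality, r × r positive
semidefinite matrices P_S, Q_x and constants l_S ≥ 0 with c - I(x_S) ≈ ⟨P_S, Q_x⟩ + l_S
(`SDPRelaxation.exists_certificate`). After rescaling, the P_S average to at most the identity and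
tr Q_x ≤ 3 (`exists_normalized_factorization`).

Put F(x) = E_S D(x_S) P_S, whose spectrum lies in [-B, B]. On average ⟨F(x), Q_x⟩ is at most a
negative multiple of η, where η is of order ε, so F has a definite amount of negative spectrum. A
large even power of B - F amplifies it: with R = (B - F)^T, the average of tr(R² (F + η)) is
negative (`trace_pow_shift_mul_le`).

On the other hand the entries of R have degree at most nT, which is much smaller than q, so a random
graph rarely meets a monomial of R in more than d/2 points. Up to a small error R therefore has
degree at most d/2 in the planted variables, where D is nonnegative on squares. This makes the
average of tr(R² F) at least -η times that of tr(R²) (`sum_pseudoDensity_trace_ge`), a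
contradiction. The error carries the factor (nT/q)^(⌊d/2⌋+1) ≤ n^(-(d-4)(⌊d/2⌋+1)), whose exponent
is about d²/2 and so beats r ≤ n^(d²/8) and the polynomial losses once d ≥ 40. The finitely many
remaining n are absorbed by K. -/

/-! ### Walsh characters and Parseval -/

/-- The sign `(-1)^b` of a bit. -/
def boolSign (b : Bool) : ℝ := if b then -1 else 1

/-- The Walsh character indexed by a finite set of coordinates. -/
def walsh {ι : Type*} (A : Finset ι) (x : ι → Bool) : ℝ := ∏ i ∈ A, boolSign (x i)

theorem boolSign_mul_self (b : Bool) : boolSign b * boolSign b = 1 := by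
  cases b <;> norm_num [boolSign]

theorem boolSign_eq_bitVal (b : Bool) : boolSign b = 1 + -2 * bitVal b := by
  cases b <;> norm_num [boolSign, bitVal]

theorem walsh_empty {ι : Type*} (x : ι → Bool) : walsh ∅ x = 1 := by simp [walsh]

theorem walsh_mul {ι : Type*} [DecidableEq ι] (A B : Finset ι) (x : ι → Bool) :
    walsh A x * walsh B x = walsh (symmDiff A B) x := by
  have hA : walsh A x = walsh (A \ B) x * walsh (A ∩ B) x := by
    rw [walsh, walsh, walsh, ← Finset.prod_union (Finset.disjoint_sdiff_inter A B),
      Finset.sdiff_union_inter]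
  have hB : walsh B x = walsh (B \ A) x * walsh (A ∩ B) x := by
    rw [Finset.inter_comm, walsh, walsh, walsh,
      ← Finset.prod_union (Finset.disjoint_sdiff_inter B A), Finset.sdiff_union_inter]
  have hAB : walsh (symmDiff A B) x = walsh (A \ B) x * walsh (B \ A) x := by
    rw [walsh, walsh, walsh, ← Finset.prod_union disjoint_sdiff_sdiff]
    rfl
  have hsq : walsh (A ∩ B) x * walsh (A ∩ B) x = 1 := by
    rw [walsh, ← Finset.prod_mul_distrib]
    exact Finset.prod_eq_one fun i _ => boolSign_mul_self _
  rw [hA, hB, hAB]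
  linear_combination (walsh (A \ B) x * walsh (B \ A) x) * hsq

theorem walsh_mul_self {ι : Type*} (A : Finset ι) (x : ι → Bool) :
    walsh A x * walsh A x = 1 := by
  rw [walsh, ← Finset.prod_mul_distrib]
  exact Finset.prod_eq_one fun i _ => boolSign_mul_self _

theorem abs_walsh {ι : Type*} (A : Finset ι) (x : ι → Bool) : |walsh A x| = 1 := by
  rw [← sq_eq_sq₀ (abs_nonneg _) zero_le_one, sq_abs, sq, walsh_mul_self, one_pow]

theorem sum_walsh {ι : Type*} [Fintype ι] [DecidableEq ι] (A : Finset ι) :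
    ∑ x : ι → Bool, walsh A x = if A = ∅ then (2 : ℝ) ^ Fintype.card ι else 0 := by
  have h : ∀ x : ι → Bool, walsh A x = ∏ i, (if i ∈ A then boolSign (x i) else 1) := by
    intro x
    rw [walsh, Finset.prod_ite_mem, Finset.univ_inter]
  simp_rw [h]
  rw [← Fintype.prod_sum (fun i b => if i ∈ A then boolSign b else 1)]
  split_ifs with hA
  · subst hA
    simp
  · obtain ⟨i, hi⟩ := Finset.nonempty_iff_ne_empty.mpr hA
    exact Finset.prod_eq_zero (Finset.mem_univ i) (by simp [hi, boolSign])

theorem sum_walsh_mul_walsh {ι : Type*} [Fintype ι] [DecidableEq ι] (A B : Finset ι) :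
    ∑ x : ι → Bool, walsh A x * walsh B x = if A = B then (2 : ℝ) ^ Fintype.card ι else 0 := by
  simp_rw [walsh_mul, sum_walsh]
  exact if_congr symmDiff_eq_bot rfl rfl

/-- Parseval's identity for a function given by its Walsh coefficients. -/
theorem sum_sq_walsh {ι : Type*} [Fintype ι] [DecidableEq ι] (a : Finset ι → ℝ) :
    ∑ x : ι → Bool, (∑ A, a A * walsh A x) ^ 2 = 2 ^ Fintype.card ι * ∑ A, a A ^ 2 := by
  have h : ∀ x : ι → Bool, (∑ A, a A * walsh A x) ^ 2
      = ∑ A, ∑ B, a A * a B * (walsh A x * walsh B x) := by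
    intro x
    rw [sq, Finset.sum_mul_sum]
    exact Finset.sum_congr rfl fun A _ => Finset.sum_congr rfl fun B _ => by ring
  simp_rw [h]
  rw [Finset.sum_comm, Finset.mul_sum]
  refine Finset.sum_congr rfl fun A _ => ?_
  rw [Finset.sum_comm]
  simp_rw [← Finset.mul_sum, sum_walsh_mul_walsh]
  simp
  ring

/-! ### Functions of low degree -/

/-- The functions on the cube `ι → Bool` spanned by the Walsh characters of degree at most `e`. -/
def lowDegree (ι : Type*) (e : ℕ) : Submodule ℝ ((ι → Bool) → ℝ) :=
  Submodule.span ℝ (walsh '' {A : Finset ι | A.card ≤ e})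

theorem walsh_mem_lowDegree {ι : Type*} {A : Finset ι} {e : ℕ} (h : A.card ≤ e) :
    walsh A ∈ lowDegree ι e :=
  Submodule.subset_span ⟨A, h, rfl⟩

theorem lowDegree_mono {ι : Type*} {e e' : ℕ} (h : e ≤ e') : lowDegree ι e ≤ lowDegree ι e' :=
  Submodule.span_mono (Set.image_mono fun _ hA => le_trans hA h)

theorem const_mem_lowDegree {ι : Type*} (a : ℝ) (e : ℕ) :
    (fun _ : ι → Bool => a) ∈ lowDegree ι e := by
  have h : (fun _ : ι → Bool => a) = a • walsh (∅ : Finset ι) := by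
    ext x
    simp [walsh_empty]
  rw [h]
  exact Submodule.smul_mem _ _ (walsh_mem_lowDegree (by simp))

theorem mul_mem_lowDegree {ι : Type*} [DecidableEq ι] {e e' : ℕ} {f g : (ι → Bool) → ℝ}
    (hf : f ∈ lowDegree ι e) (hg : g ∈ lowDegree ι e') : f * g ∈ lowDegree ι (e + e') := by
  have h := Submodule.mul_mem_mul hf hg
  rw [lowDegree, lowDegree, Submodule.span_mul_span] at h
  refine Submodule.span_le.mpr ?_ h
  rintro _ ⟨_, ⟨A, hA, rfl⟩, _, ⟨B, hB, rfl⟩, rfl⟩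
  have hAB : walsh A * walsh B = walsh (symmDiff A B) := funext fun x => walsh_mul A B x
  refine (congrArg (· ∈ lowDegree ι (e + e')) hAB).mpr (walsh_mem_lowDegree ?_)
  have h1 : symmDiff A B ⊆ A ∪ B := symmDiff_le_sup
  exact (Finset.card_le_card h1).trans ((Finset.card_union_le A B).trans (add_le_add hA hB))

theorem prod_mem_lowDegree {ι κ : Type*} [DecidableEq ι] (s : Finset κ)
    (f : κ → (ι → Bool) → ℝ) (hf : ∀ j ∈ s, f j ∈ lowDegree ι 1) :
    ∏ j ∈ s, f j ∈ lowDegree ι s.card := by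
  classical
  induction s using Finset.induction_on with
  | empty => exact const_mem_lowDegree 1 _
  | insert j s hj ih =>
    rw [Finset.prod_insert hj, Finset.card_insert_of_notMem hj, add_comm]
    exact mul_mem_lowDegree (hf j (Finset.mem_insert_self j s))
      (ih fun i hi => hf i (Finset.mem_insert_of_mem hi))

theorem boolSign_mem_lowDegree {ι : Type*} (i : ι) :
    (fun x : ι → Bool => boolSign (x i)) ∈ lowDegree ι 1 := by
  have h : (fun x : ι → Bool => boolSign (x i)) = walsh {i} := by
    ext x
    simp [walsh]
  rw [h]
  exact walsh_mem_lowDegree (by simp)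

theorem bit_mem_lowDegree {ι : Type*} (i : ι) (φ : Bool → ℝ) :
    (fun x : ι → Bool => φ (x i)) ∈ lowDegree ι 1 := by
  have h : (fun x : ι → Bool => φ (x i)) = (fun _ => (φ false + φ true) / 2) +
      ((φ false - φ true) / 2) • (fun x : ι → Bool => boolSign (x i)) := by
    ext x
    cases hx : x i <;> simp [boolSign, hx] <;> ring
  rw [h]
  exact Submodule.add_mem _ (const_mem_lowDegree _ _)
    (Submodule.smul_mem _ _ (boolSign_mem_lowDegree i))

/-- A function of `k` coordinates has degree at most `k`. -/
theorem junta_mem_lowDegree {ι : Type*} [DecidableEq ι] {k : ℕ} (f : Cube k → ℝ)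
    (v : Fin k → ι) : (fun x : ι → Bool => f (fun j => x (v j))) ∈ lowDegree ι k := by
  have h : (fun x : ι → Bool => f (fun j => x (v j))) =
      ∑ y : Cube k, f y • ∏ j, (fun x : ι → Bool => if x (v j) = y j then (1 : ℝ) else 0) := by
    ext x
    simp only [Finset.sum_apply, Pi.smul_apply, Finset.prod_apply, smul_eq_mul]
    rw [Finset.sum_eq_single (fun j => x (v j))]
    · simp
    · intro y _ hy
      obtain ⟨j, hj⟩ := Function.ne_iff.mp hy
      rw [Finset.prod_eq_zero (Finset.mem_univ j), mul_zero]
      rw [if_neg (fun h => hj h.symm)]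
    · simp
  rw [h]
  refine Submodule.sum_mem _ fun y _ => Submodule.smul_mem _ _ ?_
  have := prod_mem_lowDegree (Finset.univ : Finset (Fin k))
    (fun j => fun x : ι → Bool => if x (v j) = y j then (1 : ℝ) else 0)
    (fun j _ => bit_mem_lowDegree (v j) (fun b => if b = y j then (1 : ℝ) else 0))
  simpa using this

theorem exists_walsh_coeff {ι : Type*} [Fintype ι] {e : ℕ} {f : (ι → Bool) → ℝ}
    (hf : f ∈ lowDegree ι e) :
    ∃ a : Finset ι → ℝ, (∀ A, e < A.card → a A = 0) ∧ ∀ x, f x = ∑ A, a A * walsh A x := by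
  classical
  induction hf using Submodule.span_induction with
  | mem f hf =>
    obtain ⟨A, hA, rfl⟩ := hf
    refine ⟨fun B => if B = A then 1 else 0, fun B hB => if_neg ?_, fun x => by simp⟩
    rintro rfl
    exact absurd hA (not_le.mpr hB)
  | zero => exact ⟨0, by simp, by simp⟩
  | add f g _ _ hf hg =>
    obtain ⟨a, ha, hfa⟩ := hf
    obtain ⟨b, hb, hgb⟩ := hg
    refine ⟨a + b, fun A hA => by simp [ha A hA, hb A hA], fun x => ?_⟩
    simp [hfa, hgb, add_mul, Finset.sum_add_distrib]
  | smul c f _ hf =>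
    obtain ⟨a, ha, hfa⟩ := hf
    refine ⟨c • a, fun A hA => by simp [ha A hA], fun x => ?_⟩
    simp [hfa, Finset.mul_sum, mul_assoc]

theorem DegreeLE.mem_lowDegree {n e : ℕ} {f : Cube n → ℝ} (hf : DegreeLE f e) :
    f ∈ lowDegree (Fin n) e := by
  obtain ⟨a, ha, hfa⟩ := hf
  have h : f = ∑ A, a A • ∏ i ∈ A, (fun x : Cube n => bitVal (x i)) := by
    ext x
    simp [hfa]
  rw [h]
  refine Submodule.sum_mem _ fun A _ => ?_
  by_cases hA : e < A.card
  · simp [ha A hA]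
  · exact Submodule.smul_mem _ _ (lowDegree_mono (not_lt.mp hA)
      (prod_mem_lowDegree A _ fun i _ => bit_mem_lowDegree i bitVal))

/-- Expanding the product of the factors 1 - 2 x_i gives the monomial coefficients. -/
theorem degreeLE_walsh {n : ℕ} (A : Finset (Fin n)) : DegreeLE (walsh A) A.card := by
  refine ⟨fun B => if B ⊆ A then (-2) ^ B.card else 0, fun B hB => if_neg fun h => ?_, fun x => ?_⟩
  · exact absurd (Finset.card_le_card h) (not_le.mpr hB)
  · simp only [walsh, boolSign_eq_bitVal]
    rw [Finset.prod_one_add]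
    simp_rw [ite_mul, zero_mul]
    rw [← Finset.sum_filter]
    refine Finset.sum_congr (by ext; simp) fun B _ => ?_
    rw [Finset.prod_mul_distrib, Finset.prod_const]

theorem degreeLE_of_mem_lowDegree {n e : ℕ} {f : Cube n → ℝ} (hf : f ∈ lowDegree (Fin n) e) :
    DegreeLE f e := by
  induction hf using Submodule.span_induction with
  | mem f hf =>
    obtain ⟨A, hA, rfl⟩ := hf
    obtain ⟨a, ha, h⟩ := degreeLE_walsh A
    exact ⟨a, fun B hB => ha B (lt_of_le_of_lt hA hB), h⟩
  | zero => exact ⟨0, by simp, by simp⟩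
  | add f g _ _ hf hg =>
    obtain ⟨a, ha, hfa⟩ := hf
    obtain ⟨b, hb, hgb⟩ := hg
    refine ⟨a + b, fun A hA => by simp [ha A hA, hb A hA], fun x => ?_⟩
    simp [hfa, hgb, add_mul, Finset.sum_add_distrib]
  | smul c f _ hf =>
    obtain ⟨a, ha, hfa⟩ := hf
    refine ⟨c • a, fun A hA => by simp [ha A hA], fun x => ?_⟩
    simp [hfa, Finset.mul_sum, mul_assoc]

/-! ### The sos cone, pseudo-expectations and pseudo-densities -/

theorem IsCubeSOS.add {n d : ℕ} {f g : Cube n → ℝ} (hf : IsCubeSOS d f) (hg : IsCubeSOS d g) :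
    IsCubeSOS d (f + g) := by
  obtain ⟨t, u, hu, hfu⟩ := hf
  obtain ⟨t', u', hu', hgu⟩ := hg
  refine ⟨t + t', Fin.append u u', fun j => ?_, fun x => ?_⟩
  · refine Fin.addCases (fun i => ?_) (fun i => ?_) j
    · rw [Fin.append_left]
      exact hu i
    · rw [Fin.append_right]
      exact hu' i
  · rw [Fin.sum_univ_add]
    simp [hfu, hgu]

theorem isCubeSOS_sq {n d : ℕ} {g : Cube n → ℝ} (hg : DegreeLE g (d / 2)) :
    IsCubeSOS d (fun x => g x ^ 2) :=
  ⟨1, fun _ => g, fun _ => hg, fun x => by simp⟩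

theorem IsCubeSOS.smul {n d : ℕ} {f : Cube n → ℝ} (hf : IsCubeSOS d f) {a : ℝ} (ha : 0 ≤ a) :
    IsCubeSOS d (a • f) := by
  obtain ⟨t, u, hu, hfu⟩ := hf
  refine ⟨t, fun j => √a • u j, fun j => ?_, fun x => ?_⟩
  · exact degreeLE_of_mem_lowDegree (Submodule.smul_mem _ _ (hu j).mem_lowDegree)
  · simp only [Pi.smul_apply, smul_eq_mul, hfu, mul_pow, Real.sq_sqrt ha, Finset.mul_sum]

theorem isCubeSOS_const {n : ℕ} (d : ℕ) {a : ℝ} (ha : 0 ≤ a) :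
    IsCubeSOS d (fun _ : Cube n => a) := by
  have h := isCubeSOS_sq (n := n) (d := d)
    (degreeLE_of_mem_lowDegree (const_mem_lowDegree (√a) (d / 2)))
  simpa [Real.sq_sqrt ha] using h

theorem IsCubeSOS.nonneg {n d : ℕ} {f : Cube n → ℝ} (hf : IsCubeSOS d f) (x : Cube n) :
    0 ≤ f x := by
  obtain ⟨t, u, _, hfu⟩ := hf
  rw [hfu]
  exact Finset.sum_nonneg fun j _ => sq_nonneg _

theorem sosBound_le {n d : ℕ} {f : Cube n → ℝ} {v : ℝ} (h : IsCubeSOS d (fun x => v - f x)) :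
    sosBound d f ≤ (v : EReal) :=
  sInf_le ⟨v, rfl, h⟩

/-- Split A into two halves B and A \ B of size at most d/2; the function is half the square of χ_B
+ σ χ_{A \ B}. This is what bounds the Walsh coefficients of a pseudo-expectation by 1. -/
theorem isCubeSOS_one_add_walsh {n d : ℕ} {A : Finset (Fin n)} (hA : A.card ≤ 2 * (d / 2))
    {σ : ℝ} (hσ : σ ^ 2 = 1) : IsCubeSOS d (fun x => 1 + σ * walsh A x) := by
  obtain ⟨B, hBA, hB⟩ := Finset.exists_subset_card_eq (s := A) (n := min (d / 2) A.card)
    (min_le_right _ _)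
  have hC : (A \ B).card ≤ d / 2 := by
    rw [Finset.card_sdiff_of_subset hBA]
    omega
  have h1 : (walsh B + σ • walsh (A \ B)) ∈ lowDegree (Fin n) (d / 2) :=
    Submodule.add_mem _ (walsh_mem_lowDegree (by omega))
      (Submodule.smul_mem _ _ (walsh_mem_lowDegree hC))
  have h2 := (isCubeSOS_sq (degreeLE_of_mem_lowDegree h1)).smul (a := 1 / 2) (by norm_num)
  convert h2 using 1
  ext x
  have hp : walsh A x = walsh (A \ B) x * walsh B x := by
    rw [walsh, walsh, walsh, Finset.prod_sdiff hBA]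
  simp only [Pi.smul_apply, Pi.add_apply, smul_eq_mul, hp]
  linear_combination (-1 / 2) * walsh_mul_self B x + (-1 / 2) * walsh_mul_self (A \ B) x
    - (walsh (A \ B) x * walsh (A \ B) x) / 2 * hσ

/-- Constants are order units for the sum-of-squares cone. -/
theorem exists_isCubeSOS_const_add {n d : ℕ} {f : Cube n → ℝ}
    (hf : f ∈ lowDegree (Fin n) (2 * (d / 2))) : ∃ a : ℝ, IsCubeSOS d (fun x => a + f x) := by
  -- Both signs are carried along so that the induction survives multiplication by a negative
  -- scalar.
  suffices h : ∃ a : ℝ, IsCubeSOS d (fun x => a + f x) ∧ IsCubeSOS d (fun x => a - f x) from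
    ⟨h.choose, h.choose_spec.1⟩
  induction hf using Submodule.span_induction with
  | mem f hf =>
    obtain ⟨A, hA, rfl⟩ := hf
    refine ⟨1, ?_, ?_⟩
    · simpa using isCubeSOS_one_add_walsh (σ := 1) hA (by norm_num)
    · simpa [sub_eq_add_neg] using isCubeSOS_one_add_walsh (σ := -1) hA (by norm_num)
  | zero =>
    refine ⟨0, ?_, ?_⟩ <;> simpa using isCubeSOS_const d le_rfl
  | add f g _ _ hf hg =>
    obtain ⟨a, ha, ha'⟩ := hf
    obtain ⟨b, hb, hb'⟩ := hg
    refine ⟨a + b, ?_, ?_⟩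
    · convert ha.add hb using 1
      ext x
      simp
      ring
    · convert ha'.add hb' using 1
      ext x
      simp
      ring
  | smul c f _ hf =>
    obtain ⟨a, ha, ha'⟩ := hf
    refine ⟨|c| * a, ?_, ?_⟩
    · rcases abs_cases c with ⟨h, _⟩ | ⟨h, _⟩
      · convert ha.smul (abs_nonneg c) using 1
        ext x
        simp [h]
        ring
      · convert ha'.smul (abs_nonneg c) using 1
        ext x
        simp [h]
        ring
    · rcases abs_cases c with ⟨h, _⟩ | ⟨h, _⟩
      · convert ha'.smul (abs_nonneg c) using 1
        ext x
        simp [h]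
        ring
      · convert ha.smul (abs_nonneg c) using 1
        ext x
        simp [h]
        ring

/-- If the sos value of `f` exceeds `v`, a pseudo-expectation certifies it. -/
theorem exists_pseudoExpectation {n d : ℕ} {f : Cube n → ℝ} {v : ℝ}
    (hf : f ∈ lowDegree (Fin n) (2 * (d / 2))) (hv : ¬ sosBound d f ≤ (v : EReal)) :
    ∃ L : (Cube n → ℝ) →ₗ[ℝ] ℝ, L (fun _ => 1) = 1 ∧ L (fun x => v - f x) ≤ 0 ∧
      ∀ p ∈ lowDegree (Fin n) (2 * (d / 2)), IsCubeSOS d p → 0 ≤ L p := by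
  set E := lowDegree (Fin n) (2 * (d / 2)) with hE
  set u : Cube n → ℝ := fun x => v - f x with hu
  have huE : u ∈ E := Submodule.sub_mem _ (const_mem_lowDegree v _) hf
  let one : E := ⟨fun _ => 1, const_mem_lowDegree 1 _⟩
  have hone : one ≠ 0 := by
    intro h
    have := congrFun (congrArg Subtype.val h) (fun _ => false)
    simp [one] at this
  -- The sos cone enlarged by the ray through -u. A functional nonnegative on C is nonnegative on
  -- sums of squares and nonpositive at u.
  let C : PointedCone ℝ E :=
    { carrier := {p | ∃ b : ℝ, 0 ≤ b ∧ IsCubeSOS d ((p : Cube n → ℝ) + b • u)}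
      add_mem' := by
        rintro p p' ⟨b, hb, h⟩ ⟨b', hb', h'⟩
        refine ⟨b + b', add_nonneg hb hb', ?_⟩
        convert h.add h' using 1
        ext x
        simp
        ring
      zero_mem' := ⟨0, le_rfl, by
        convert isCubeSOS_const (n := n) d le_rfl using 1
        ext x
        simp⟩
      smul_mem' := by
        rintro ⟨a, ha⟩ p ⟨b, hb, h⟩
        refine ⟨a * b, mul_nonneg ha hb, ?_⟩
        convert h.smul ha using 1
        ext x
        simp [Nonneg.mk_smul]
        ring }
  let F : E →ₗ.[ℝ] ℝ := LinearPMap.mkSpanSingleton one (1 : ℝ) hone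
  obtain ⟨g, hg1, hg2⟩ := riesz_extension C F (by
      rintro ⟨y, hy⟩ hyC
      obtain ⟨a, rfl⟩ := Submodule.mem_span_singleton.mp hy
      have hF : F ⟨a • one, hy⟩ = a :=
        (LinearPMap.mkSpanSingleton'_apply _ _ _ a hy).trans (by simp)
      rw [hF]
      obtain ⟨b, hb, h⟩ := hyC
      by_contra! ha
      rcases hb.eq_or_lt with rfl | hb
      · have := h.nonneg (fun _ => false)
        simp [one] at this
        linarith
      -- If a + b u is sos with a < 0 < b, adding the constant -a and dividing by b shows that u
      -- itself is sos, contrary to `hv`.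
      · apply hv
        apply sosBound_le
        convert (h.add (isCubeSOS_const d (neg_nonneg.mpr ha.le))).smul
          (a := b⁻¹) (inv_nonneg.mpr hb.le) using 1
        ext x
        simp [one, hu]
        field_simp) (by
      rintro ⟨y, hy⟩
      obtain ⟨a, ha⟩ := exists_isCubeSOS_const_add hy
      refine ⟨⟨a • one, Submodule.mem_span_singleton.mpr ⟨a, rfl⟩⟩, 0, le_rfl, ?_⟩
      convert ha using 1
      ext x
      simp [one])
  obtain ⟨L, hL⟩ := g.exists_extend
  have hLg : ∀ p (hp : p ∈ E), L p = g ⟨p, hp⟩ := fun p hp => LinearMap.congr_fun hL ⟨p, hp⟩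
  refine ⟨L, ?_, ?_, fun p hp hps => ?_⟩
  · rw [hLg _ (const_mem_lowDegree 1 _)]
    have := hg1 ⟨one, Submodule.mem_span_singleton_self one⟩
    rw [LinearPMap.mkSpanSingleton_apply] at this
    exact this
  · rw [hLg _ huE]
    have : 0 ≤ g (-⟨u, huE⟩) := hg2 _ ⟨1, zero_le_one, by
      convert isCubeSOS_const (n := n) d le_rfl using 1
      ext x
      simp⟩
    rw [map_neg] at this
    linarith
  · rw [hLg _ hp]
    exact hg2 _ ⟨0, le_rfl, by simpa using hps⟩

theorem card_filter_card_le (n e : ℕ) :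
    ((Finset.univ : Finset (Finset (Fin n))).filter (fun A => A.card ≤ e)).card ≤ (n + 1) ^ e := by
  have h : (Finset.univ : Finset (Finset (Fin n))).filter (fun A => A.card ≤ e) ⊆
      (Finset.range (e + 1)).biUnion fun i => Finset.powersetCard i Finset.univ := by
    intro A hA
    simp only [Finset.mem_filter, Finset.mem_univ, true_and] at hA
    simp only [Finset.mem_biUnion, Finset.mem_range, Finset.mem_powersetCard]
    exact ⟨A.card, by omega, Finset.subset_univ A, rfl⟩
  refine (Finset.card_le_card h).trans (Finset.card_biUnion_le.trans ?_)
  rw [add_pow]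
  refine Finset.sum_le_sum fun i hi => ?_
  rw [Finset.card_powersetCard, Finset.card_univ, Fintype.card_fin, one_pow, mul_one]
  exact (Nat.choose_le_pow n i).trans
    (Nat.le_mul_of_pos_right _ (Nat.choose_pos (by simpa [Nat.lt_succ_iff] using hi)))

/-- A bounded degree-`d` pseudo-density certifying a lower bound on the sos value. -/
theorem exists_pseudoDensity {n d : ℕ} {f : Cube n → ℝ} {v : ℝ}
    (hf : f ∈ lowDegree (Fin n) (2 * (d / 2))) (hv : ¬ sosBound d f ≤ (v : EReal)) :
    ∃ D : Cube n → ℝ, (∀ x, |D x| ≤ ((n : ℝ) + 1) ^ d) ∧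
      (∀ g ∈ lowDegree (Fin n) (d / 2), 0 ≤ ∑ x, D x * g x ^ 2) ∧
      ∑ x, D x = 2 ^ n ∧ ∑ x, D x * (v - f x) ≤ 0 := by
  obtain ⟨L, hL1, hLu, hL⟩ := exists_pseudoExpectation hf hv
  set s := (Finset.univ : Finset (Finset (Fin n))).filter (fun A => A.card ≤ 2 * (d / 2)) with hs
  -- The function of degree at most 2⌊d/2⌋ that represents L under the normalized inner product.
  let D : Cube n → ℝ := fun x => ∑ A ∈ s, L (walsh A) * walsh A x
  have hLabs : ∀ A ∈ s, |L (walsh A)| ≤ 1 := by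
    intro A hA
    have hA : A.card ≤ 2 * (d / 2) := by simpa [hs] using hA
    have key : ∀ σ : ℝ, σ ^ 2 = 1 → 0 ≤ 1 + σ * L (walsh A) := by
      intro σ hσ
      have h := hL (fun x => 1 + σ * walsh A x) (Submodule.add_mem _ (const_mem_lowDegree 1 _)
        (Submodule.smul_mem _ σ (walsh_mem_lowDegree hA))) (isCubeSOS_one_add_walsh hA hσ)
      have h' : (fun x => 1 + σ * walsh A x) = (fun _ => (1 : ℝ)) + σ • walsh A := rfl
      rwa [h', map_add, map_smul, hL1, smul_eq_mul] at h
    have h1 := key 1 (by norm_num)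
    have h2 := key (-1) (by norm_num)
    exact abs_le.mpr ⟨by linarith, by linarith⟩
  have hDL : ∀ p ∈ lowDegree (Fin n) (2 * (d / 2)), ∑ x, D x * p x = 2 ^ n * L p := by
    intro p hp
    induction hp using Submodule.span_induction with
    | mem p hp =>
      obtain ⟨B, hB, rfl⟩ := hp
      simp only [D, Finset.sum_mul]
      rw [Finset.sum_comm]
      simp_rw [mul_assoc, ← Finset.mul_sum, sum_walsh_mul_walsh]
      rw [Finset.sum_eq_single B]
      · simp [mul_comm]
      · intro A _ hA
        simp [hA]
      · intro h
        exact absurd (by simpa [hs] using hB) h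
    | zero => simp
    | add p q _ _ hp hq => simp [mul_add, Finset.sum_add_distrib, hp, hq]
    | smul c p _ hp =>
      have : ∀ x, D x * (c • p) x = c * (D x * p x) := fun x => by
        simp
        ring
      simp_rw [this]
      rw [← Finset.mul_sum, hp, map_smul, smul_eq_mul]
      ring
  refine ⟨D, fun x => ?_, fun g hg => ?_, ?_, ?_⟩
  · calc |D x| ≤ ∑ A ∈ s, |L (walsh A) * walsh A x| := Finset.abs_sum_le_sum_abs _ _
      _ ≤ ∑ A ∈ s, (1 : ℝ) := Finset.sum_le_sum fun A hA => by
          rw [abs_mul, abs_walsh, mul_one]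
          exact hLabs A hA
      _ = (s.card : ℝ) := by simp
      _ ≤ ((n : ℝ) + 1) ^ (2 * (d / 2)) := by exact_mod_cast card_filter_card_le n _
      _ ≤ ((n : ℝ) + 1) ^ d := pow_le_pow_right₀ (by linarith [Nat.cast_nonneg (α := ℝ) n])
          (by omega)
  · have hmem : (fun x => g x ^ 2) ∈ lowDegree (Fin n) (2 * (d / 2)) := by
      have := mul_mem_lowDegree hg hg
      rw [← two_mul] at this
      convert this using 1
      ext x
      simp [sq]
    rw [hDL _ hmem]
    exact mul_nonneg (by positivity)
      (hL _ hmem (isCubeSOS_sq (degreeLE_of_mem_lowDegree hg)))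
  · have := hDL _ (const_mem_lowDegree 1 _)
    simpa [hL1] using this
  · rw [hDL (fun x => v - f x) (Submodule.sub_mem _ (const_mem_lowDegree v _) hf)]
    exact mul_nonpos_of_nonneg_of_nonpos (by positivity) hLu

theorem CSPInstance.value_mem_lowDegree {k n : ℕ} {P : BoolCSP k} (I : CSPInstance P n) :
    I.value ∈ lowDegree (Fin n) k := by
  have h : I.value = (1 / (I.size : ℝ)) • ∑ j, (I.constraint j).value := by
    ext x
    simp [CSPInstance.value]
  rw [h]
  exact Submodule.smul_mem _ _ (Submodule.sum_mem _ fun j _ =>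
    junta_mem_lowDegree (fun y => bitVal ((I.constraint j).pred y)) (I.constraint j).vars)

/-! ### Positive semidefinite matrices and the trace inner product -/

open scoped MatrixOrder in
theorem Matrix.PosSemidef.exists_transpose_mul_self {r : ℕ} {M : Matrix (Fin r) (Fin r) ℝ}
    (hM : M.PosSemidef) : ∃ C : Matrix (Fin r) (Fin r) ℝ, M = C.transpose * C := by
  obtain ⟨C, hC⟩ := CStarAlgebra.nonneg_iff_eq_star_mul_self.mp hM.nonneg
  exact ⟨C, by rw [hC, Matrix.star_eq_conjTranspose, Matrix.conjTranspose_eq_transpose_of_trivial]⟩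

theorem Matrix.PosSemidef.transpose_eq {r : ℕ} {M : Matrix (Fin r) (Fin r) ℝ}
    (hM : M.PosSemidef) : M.transpose = M := by
  have h := hM.isHermitian
  rwa [Matrix.IsHermitian, Matrix.conjTranspose_eq_transpose_of_trivial] at h

theorem frobInner_nonneg {r : ℕ} {A B : Matrix (Fin r) (Fin r) ℝ} (hA : A.PosSemidef)
    (hB : B.PosSemidef) : 0 ≤ frobInner A B := by
  obtain ⟨C, rfl⟩ := hA.exists_transpose_mul_self
  have h : frobInner (C.transpose * C) B = (C * B * C.transpose).trace := by
    rw [frobInner, Matrix.transpose_mul, Matrix.transpose_transpose, Matrix.trace_mul_comm,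
      ← Matrix.mul_assoc, Matrix.trace_mul_comm, ← Matrix.mul_assoc]
  rw [h]
  have := (hB.mul_mul_conjTranspose_same C).trace_nonneg
  rwa [Matrix.conjTranspose_eq_transpose_of_trivial] at this

theorem frobInner_add_left {r : ℕ} (A B C : Matrix (Fin r) (Fin r) ℝ) :
    frobInner (A + B) C = frobInner A C + frobInner B C := by
  simp [frobInner, Matrix.add_mul]

theorem frobInner_smul_left {r : ℕ} (a : ℝ) (A B : Matrix (Fin r) (Fin r) ℝ) :
    frobInner (a • A) B = a * frobInner A B := by
  simp [frobInner]

theorem frobInner_smul_right {r : ℕ} (a : ℝ) (A B : Matrix (Fin r) (Fin r) ℝ) :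
    frobInner A (a • B) = a * frobInner A B := by
  simp [frobInner]

theorem frobInner_sum_right {r : ℕ} {ι : Type*} (s : Finset ι) (A : Matrix (Fin r) (Fin r) ℝ)
    (B : ι → Matrix (Fin r) (Fin r) ℝ) :
    frobInner A (∑ i ∈ s, B i) = ∑ i ∈ s, frobInner A (B i) := by
  simp [frobInner, Matrix.mul_sum, Matrix.trace_sum]

theorem frobInner_vecMulVec {r : ℕ} (v : Fin r → ℝ) (B : Matrix (Fin r) (Fin r) ℝ) :
    frobInner (Matrix.vecMulVec v v) B = v ⬝ᵥ (B.mulVec v) := by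
  rw [frobInner, Matrix.transpose_vecMulVec, Matrix.vecMulVec_mul, Matrix.trace_vecMulVec,
    dotProduct_comm, ← Matrix.dotProduct_mulVec]

/-! ### Duality for SDP relaxations -/

/-- A signed combination of the linearized assignments that is positive semidefinite and has
positive total weight is, after rescaling, feasible. -/
theorem SDPRelaxation.sum_mul_value_le {k n r : ℕ} {P : BoolCSP k} (R : SDPRelaxation P n r)
    (I : CSPInstance P n) {c : ℝ} (hI : R.value I ≤ (c : EReal)) (w : Cube n → ℝ)
    (hw : 0 < ∑ x, w x) (hpsd : (∑ x, w x • R.linAssignment x).PosSemidef) :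
    0 ≤ ∑ x, w x * (c - I.value x) := by
  set W := ∑ x, w x with hW
  have hfeas : W⁻¹ • ∑ x, w x • R.linAssignment x ∈ R.feasible := by
    refine ⟨hpsd.smul (inv_nonneg.mpr hw.le), ?_⟩
    rw [map_smul, map_sum]
    simp_rw [map_smul, R.map_assignment]
    rw [← Finset.sum_smul, smul_smul, inv_mul_cancel₀ hw.ne', one_smul]
  have h1 : ((frobInner (R.linInstance I) (W⁻¹ • ∑ x, w x • R.linAssignment x) : ℝ) : EReal)
      ≤ (c : EReal) := le_trans (le_iSup₂ (f := fun y (_ : y ∈ R.feasible) =>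
        ((frobInner (R.linInstance I) y : ℝ) : EReal)) _ hfeas) hI
  rw [EReal.coe_le_coe_iff, frobInner_smul_right, frobInner_sum_right,
    inv_mul_le_iff₀ hw] at h1
  simp_rw [frobInner_smul_right, R.inner_eq] at h1
  simp_rw [mul_sub]
  rw [Finset.sum_sub_distrib, ← Finset.sum_mul]
  linarith

/-- Approximate duality: no constraint qualification is needed. -/
theorem SDPRelaxation.exists_certificate {k n r : ℕ} {P : BoolCSP k} (R : SDPRelaxation P n r)
    (I : CSPInstance P n) {c : ℝ} (hI : R.value I ≤ (c : EReal)) {δ : ℝ} (hδ : 0 < δ) :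
    ∃ M : Matrix (Fin r) (Fin r) ℝ, M.PosSemidef ∧ ∃ l : ℝ, 0 ≤ l ∧
      ∀ x, |c - I.value x - (frobInner M (R.linAssignment x) + l)| ≤ δ := by
  let K : Set (Cube n → ℝ) := {φ | ∃ M : Matrix (Fin r) (Fin r) ℝ, M.PosSemidef ∧ ∃ l : ℝ,
    0 ≤ l ∧ φ = fun x => frobInner M (R.linAssignment x) + l}
  have hKsmul : ∀ a : ℝ, 0 ≤ a → ∀ φ ∈ K, a • φ ∈ K := by
    rintro a ha _ ⟨M, hM, l, hl, rfl⟩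
    refine ⟨a • M, hM.smul ha, a * l, mul_nonneg ha hl, ?_⟩
    ext x
    simp [frobInner_smul_left, mul_add]
  have hKadd : ∀ φ ∈ K, ∀ ψ ∈ K, φ + ψ ∈ K := by
    rintro _ ⟨M, hM, l, hl, rfl⟩ _ ⟨M', hM', l', hl', rfl⟩
    refine ⟨M + M', hM.add hM', l + l', add_nonneg hl hl', ?_⟩
    ext x
    simp [frobInner_add_left]
    ring
  have hKconv : Convex ℝ K := fun φ hφ ψ hψ a b ha hb _ =>
    hKadd _ (hKsmul a ha φ hφ) _ (hKsmul b hb ψ hψ)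
  set φ₀ : Cube n → ℝ := fun x => c - I.value x with hφ₀
  have hmem : φ₀ ∈ closure K := by
    by_contra hnot
    obtain ⟨f, u, hfu, hfK⟩ :=
      geometric_hahn_banach_point_closed hKconv.closure isClosed_closure hnot
    have hu : u < 0 := by
      have := hfK 0 (subset_closure ⟨0, Matrix.PosSemidef.zero, 0, le_rfl, by
        ext x
        simp [frobInner]⟩)
      simpa using this
    have hfnn : ∀ φ ∈ K, 0 ≤ f φ := by
      intro φ hφ
      by_contra! hneg
      -- The scaling moves the value of f to exactly u, while f is strictly above u on the closure
      -- of K.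
      have h := hfK _ (subset_closure (hKsmul (u / f φ) (div_nonneg_of_nonpos hu.le hneg.le) φ hφ))
      rw [map_smul, smul_eq_mul, div_mul_cancel₀ _ hneg.ne] at h
      exact lt_irrefl _ h
    set w : Cube n → ℝ := fun x => f (Pi.single x 1) with hw
    have hfw : ∀ φ : Cube n → ℝ, f φ = ∑ x, w x * φ x := by
      intro φ
      have := LinearMap.pi_apply_eq_sum_univ f.toLinearMap φ
      simp only [ContinuousLinearMap.coe_coe, smul_eq_mul] at this
      rw [this]
      refine Finset.sum_congr rfl fun x _ => ?_
      rw [mul_comm]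
      congr 2
      ext y
      simp [Pi.single_apply, eq_comm]
    have hfφ₀ : f φ₀ < 0 := hfu.trans hu
    -- The separating weights may have total weight zero. Adding a small τ to each makes the total
    -- positive and keeps the value at φ₀ negative.
    obtain ⟨τ, hτ, hτφ⟩ : ∃ τ : ℝ, 0 < τ ∧ f φ₀ + τ * ∑ x, φ₀ x < 0 := by
      refine ⟨-f φ₀ / (|∑ x, φ₀ x| + 1), div_pos (neg_pos.mpr hfφ₀) (by positivity), ?_⟩
      have hpos : 0 < |∑ x, φ₀ x| + 1 := by positivity
      have h1 : -f φ₀ / (|∑ x, φ₀ x| + 1) * ∑ x, φ₀ x ≤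
          -f φ₀ / (|∑ x, φ₀ x| + 1) * |∑ x, φ₀ x| :=
        mul_le_mul_of_nonneg_left (le_abs_self _) (div_pos (neg_pos.mpr hfφ₀) hpos).le
      have h2 : -f φ₀ / (|∑ x, φ₀ x| + 1) * |∑ x, φ₀ x| < -f φ₀ := by
        rw [div_mul_eq_mul_div, div_lt_iff₀ hpos]
        nlinarith
      linarith
    have hsum : 0 < ∑ x, (w x + τ) := by
      have h1 : 0 ≤ f (fun _ => 1) := hfnn _ ⟨0, Matrix.PosSemidef.zero, 1, zero_le_one, by
        ext x
        simp [frobInner]⟩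
      rw [hfw] at h1
      rw [Finset.sum_add_distrib]
      have h2 : 0 < ∑ _x : Cube n, τ := Finset.sum_pos (fun _ _ => hτ) Finset.univ_nonempty
      simp only [mul_one] at h1
      linarith
    -- Nonnegativity of f on the rank-one elements M = v vᵀ of K says exactly that the quadratic
    -- form of ∑ w x • `linAssignment x` is nonnegative at v.
    have hpsd : (∑ x, (w x + τ) • R.linAssignment x).PosSemidef := by
      refine Matrix.PosSemidef.of_dotProduct_mulVec_nonneg ?_ fun v => ?_
      · rw [Matrix.IsHermitian, Matrix.conjTranspose_eq_transpose_of_trivial,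
          Matrix.transpose_sum]
        refine Finset.sum_congr rfl fun x _ => ?_
        rw [Matrix.transpose_smul, (R.posSemidef_assignment x).transpose_eq]
      · rw [star_trivial, ← frobInner_vecMulVec, frobInner_sum_right]
        have hv : (Matrix.vecMulVec v v).PosSemidef := by
          simpa using Matrix.posSemidef_vecMulVec_self_star v
        have h1 : 0 ≤ f (fun x => frobInner (Matrix.vecMulVec v v) (R.linAssignment x)) :=
          hfnn _ ⟨_, hv, 0, le_rfl, by simp⟩
        rw [hfw] at h1
        simp_rw [frobInner_smul_right, add_mul]
        rw [Finset.sum_add_distrib]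
        exact add_nonneg h1 (Finset.sum_nonneg fun x _ => mul_nonneg hτ.le
          (frobInner_nonneg hv (R.posSemidef_assignment x)))
    have h := R.sum_mul_value_le I hI _ hsum hpsd
    simp_rw [add_mul] at h
    rw [Finset.sum_add_distrib, ← Finset.mul_sum] at h
    rw [hfw] at hτφ
    linarith
  obtain ⟨φ, ⟨M, hM, l, hl, rfl⟩, hdist⟩ := Metric.mem_closure_iff.mp hmem δ hδ
  refine ⟨M, hM, l, hl, fun x => ?_⟩
  have := (dist_pi_lt_iff hδ).mp hdist x
  rw [Real.dist_eq] at this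
  exact this.le

/-! ### Normalizing a factorization -/

/-- A positive semidefinite factorization can be rescaled so that the left factors average to at
most the identity and the right factors have bounded trace. -/
theorem exists_normalized_factorization {r : ℕ} {σ X : Type*} [Fintype σ] [Nonempty σ] [Fintype X]
    (P : σ → Matrix (Fin r) (Fin r) ℝ) (Q : X → Matrix (Fin r) (Fin r) ℝ)
    (hP : ∀ S, (P S).PosSemidef) (hQ : ∀ x, (Q x).PosSemidef) {t : ℝ}
    (hPQ : ∀ S x, frobInner (P S) (Q x) ≤ t) :
    ∃ (P' : σ → Matrix (Fin r) (Fin r) ℝ) (Q' : X → Matrix (Fin r) (Fin r) ℝ),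
      (∀ S, (P' S).PosSemidef) ∧ (∀ x, (Q' x).PosSemidef) ∧
      (∀ S x, frobInner (P' S) (Q' x) = frobInner (P S) (Q x)) ∧
      ((Fintype.card σ : ℝ) • (1 : Matrix (Fin r) (Fin r) ℝ) - ∑ S, P' S).PosSemidef ∧
      ∀ x, (Q' x).trace ≤ 1 + t := by
  set M : ℝ := (Fintype.card σ : ℝ) with hM
  have hM0 : 0 < M := by
    rw [hM]
    exact_mod_cast Fintype.card_pos
  have hT : 0 ≤ ∑ x, (Q x).trace := Finset.sum_nonneg fun x _ => (hQ x).trace_nonneg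
  -- The regularization δ makes the averaged left factor `Pb` invertible, and is small enough that δ
  -- tr Q_x ≤ 1.
  set δ : ℝ := 1 / (1 + ∑ x, (Q x).trace) with hδ
  have hδ0 : 0 < δ := by positivity
  set Pb : Matrix (Fin r) (Fin r) ℝ := δ • 1 + M⁻¹ • ∑ S, P S with hPb
  have hPbdef : Pb.PosDef := (Matrix.PosDef.one.smul hδ0).add_posSemidef
    ((Matrix.posSemidef_sum _ fun S _ => hP S).smul (inv_nonneg.mpr hM0.le))
  -- Conjugating by C turns `Pb` into the identity. The trace of the new right factor is then ⟨Pb,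
  -- Q_x⟩, namely δ tr Q_x plus an average of the entries ⟨P_S, Q_x⟩.
  obtain ⟨C, hC⟩ := hPbdef.posSemidef.exists_transpose_mul_self
  have hdet : IsUnit C.det := by
    have h := (Matrix.isUnit_iff_isUnit_det _).mp hPbdef.isUnit
    rw [hC, Matrix.det_mul] at h
    exact isUnit_of_mul_isUnit_right h
  have hC1 : C⁻¹ * C = 1 := Matrix.nonsing_inv_mul _ hdet
  have hC2 : C * C⁻¹ = 1 := Matrix.mul_nonsing_inv _ hdet
  have hC3 : C.transpose * C⁻¹.transpose = 1 := by
    rw [← Matrix.transpose_mul, hC1, Matrix.transpose_one]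
  have hC4 : C⁻¹.transpose * C.transpose = 1 := by
    rw [← Matrix.transpose_mul, hC2, Matrix.transpose_one]
  refine ⟨fun S => C⁻¹.transpose * P S * C⁻¹, fun x => C * Q x * C.transpose, fun S => ?_,
    fun x => ?_, fun S x => ?_, ?_, fun x => ?_⟩
  · simpa [Matrix.conjTranspose_eq_transpose_of_trivial] using
      (hP S).conjTranspose_mul_mul_same C⁻¹
  · simpa [Matrix.conjTranspose_eq_transpose_of_trivial] using
      (hQ x).mul_mul_conjTranspose_same C
  · simp only [frobInner, Matrix.transpose_mul, Matrix.transpose_transpose]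
    calc (C⁻¹.transpose * ((P S).transpose * C⁻¹) * (C * Q x * C.transpose)).trace
        = (C⁻¹.transpose * (P S).transpose * (C⁻¹ * C) * Q x * C.transpose).trace := by
          simp only [Matrix.mul_assoc]
      _ = ((C.transpose * C⁻¹.transpose) * (P S).transpose * Q x).trace := by
          rw [hC1, Matrix.mul_one, Matrix.trace_mul_comm]
          simp only [Matrix.mul_assoc]
      _ = _ := by rw [hC3, Matrix.one_mul]
  · have h : M • (1 : Matrix (Fin r) (Fin r) ℝ) - ∑ S, C⁻¹.transpose * P S * C⁻¹ =
        C⁻¹.transpose * ((M * δ) • (1 : Matrix (Fin r) (Fin r) ℝ)) * C⁻¹ := by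
      rw [← Finset.sum_mul, ← Finset.mul_sum]
      have h1 : ∑ S, P S = M • (C.transpose * C) - (M * δ) • (1 : Matrix (Fin r) (Fin r) ℝ) := by
        rw [← hC, hPb, smul_add, smul_smul, smul_smul, mul_inv_cancel₀ hM0.ne', one_smul]
        abel
      have h2 : C⁻¹.transpose * (C.transpose * C) * C⁻¹ = 1 := by
        rw [← Matrix.mul_assoc, hC4, Matrix.one_mul, hC2]
      rw [h1, Matrix.mul_sub, Matrix.sub_mul, Matrix.mul_smul, Matrix.smul_mul, h2]
      abel
    rw [h]
    simpa [Matrix.conjTranspose_eq_transpose_of_trivial] using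
      (Matrix.PosSemidef.one.smul (mul_nonneg hM0.le hδ0.le)).conjTranspose_mul_mul_same C⁻¹
  · have h : (C * Q x * C.transpose).trace = δ * (Q x).trace + M⁻¹ * ∑ S, frobInner (P S) (Q x) := by
      rw [Matrix.mul_assoc, Matrix.trace_mul_comm, Matrix.mul_assoc, ← hC, hPb, Matrix.mul_add,
        Matrix.trace_add, Matrix.mul_smul, Matrix.mul_smul, Matrix.mul_one, Matrix.trace_smul,
        Matrix.trace_smul, Matrix.mul_sum, Matrix.trace_sum, smul_eq_mul, smul_eq_mul]
      congr 2
      refine Finset.sum_congr rfl fun S _ => ?_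
      rw [frobInner, (hP S).transpose_eq, Matrix.trace_mul_comm]
    rw [h]
    have h1 : δ * (Q x).trace ≤ 1 := by
      rw [hδ, one_div, inv_mul_le_iff₀ (by positivity)]
      have := Finset.single_le_sum (f := fun x => (Q x).trace)
        (fun x _ => (hQ x).trace_nonneg) (Finset.mem_univ x)
      linarith
    have h2 : M⁻¹ * ∑ S, frobInner (P S) (Q x) ≤ t := by
      rw [inv_mul_le_iff₀ hM0]
      calc ∑ S, frobInner (P S) (Q x) ≤ ∑ _S : σ, t := Finset.sum_le_sum fun S _ => hPQ S x
        _ = M * t := by simp [hM]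
    linarith

/-! ### Spectral amplification of the negative part -/

theorem Matrix.IsHermitian.exists_orthogonal_diagonalization {r : ℕ}
    {F : Matrix (Fin r) (Fin r) ℝ} (hF : F.IsHermitian) :
    ∃ (U : Matrix (Fin r) (Fin r) ℝ) (l : Fin r → ℝ), U.transpose * U = 1 ∧ U * U.transpose = 1 ∧
      F = U * Matrix.diagonal l * U.transpose := by
  refine ⟨hF.eigenvectorUnitary, hF.eigenvalues, ?_, ?_, ?_⟩
  · have := Unitary.coe_star_mul_self hF.eigenvectorUnitary
    rwa [Matrix.star_eq_conjTranspose, Matrix.conjTranspose_eq_transpose_of_trivial] at this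
  · have := Unitary.coe_mul_star_self hF.eigenvectorUnitary
    rwa [Unitary.coe_star, Matrix.star_eq_conjTranspose, Matrix.conjTranspose_eq_transpose_of_trivial] at this
  · have := hF.spectral_theorem
    rw [Unitary.conjStarAlgAut_apply, Matrix.star_eq_conjTranspose,
      Matrix.conjTranspose_eq_transpose_of_trivial] at this
    exact this

/-- The scalar inequality applied to each eigenvalue l. For l ≥ -η both factors are controlled by b
+ η; in between the left side is nonpositive; for l ≤ -2η the weight is at least (b + 2η)^(2T). The
exponential gap between b + η and b + 2η is what defeats the dimension factor r. -/
theorem pow_shift_mul_le {b η l : ℝ} (hη : 0 < η) (hl : l ≤ b) (hl' : -b ≤ l) (T : ℕ) :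
    (b - l) ^ T * (b - l) ^ T * (l + η) ≤
      (b + η) ^ (2 * T + 1) + (b + 2 * η) ^ (2 * T) * min 0 (l + 2 * η) := by
  have hb : 0 ≤ b := by linarith
  rw [← pow_add, ← two_mul]
  rcases le_total (-η) l with h1 | h1
  · rw [min_eq_left (by linarith), mul_zero, add_zero, pow_succ]
    exact mul_le_mul (pow_le_pow_left₀ (by linarith) (by linarith) _) (by linarith)
      (by linarith) (by positivity)
  · have hneg : (b - l) ^ (2 * T) * (l + η) ≤ 0 :=
      mul_nonpos_of_nonneg_of_nonpos (pow_nonneg (by linarith) _) (by linarith)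
    have hpos : 0 ≤ (b + η) ^ (2 * T + 1) := by positivity
    rcases le_total (-(2 * η)) l with h2 | h2
    · rw [min_eq_left (by linarith), mul_zero, add_zero]
      linarith
    · rw [min_eq_right (by linarith)]
      have h3 : (b + 2 * η) ^ (2 * T) ≤ (b - l) ^ (2 * T) :=
        pow_le_pow_left₀ (by linarith) (by linarith) _
      have h4 : (b - l) ^ (2 * T) * (l + 2 * η) ≤ (b + 2 * η) ^ (2 * T) * (l + 2 * η) :=
        mul_le_mul_of_nonpos_right h3 (by linarith)
      have h5 : (b - l) ^ (2 * T) * (l + η) ≤ (b - l) ^ (2 * T) * (l + 2 * η) :=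
        mul_le_mul_of_nonneg_left (by linarith) (pow_nonneg (by linarith) _)
      linarith

/-- The spectral weight of `(b - F) ^ (2 T)` concentrates on the negative part of `F`, as soon as
some bounded `Q` does. -/
theorem trace_pow_shift_mul_le {r : ℕ} {F Q : Matrix (Fin r) (Fin r) ℝ} {b η t : ℝ}
    (hη : 0 < η) (ht : 0 < t) (hF : F.IsHermitian)
    (hF1 : (b • (1 : Matrix (Fin r) (Fin r) ℝ) - F).PosSemidef)
    (hF2 : (b • (1 : Matrix (Fin r) (Fin r) ℝ) + F).PosSemidef) (hQ : Q.PosSemidef)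
    (hQt : Q.trace ≤ t) (T : ℕ) :
    ((b • 1 - F) ^ T * (b • 1 - F) ^ T * (F + η • 1)).trace ≤
      r * (b + η) ^ (2 * T + 1) +
        (b + 2 * η) ^ (2 * T) / t * ((Q * F).trace + 2 * η * Q.trace) := by
  obtain ⟨U, l, hU1, hU2, hFU⟩ := hF.exists_orthogonal_diagonalization
  have hconj : ∀ v w : Fin r → ℝ, (U * Matrix.diagonal v * U.transpose) *
      (U * Matrix.diagonal w * U.transpose) =
      U * Matrix.diagonal (fun i => v i * w i) * U.transpose := by
    intro v w
    calc _ = U * Matrix.diagonal v * (U.transpose * U) * Matrix.diagonal w * U.transpose := by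
          simp only [Matrix.mul_assoc]
      _ = _ := by
          rw [hU1, Matrix.mul_one, Matrix.mul_assoc U, Matrix.diagonal_mul_diagonal]
  have hshift : ∀ a c : ℝ, a • (1 : Matrix (Fin r) (Fin r) ℝ) + c • F =
      U * Matrix.diagonal (fun i => a + c * l i) * U.transpose := by
    intro a c
    have : Matrix.diagonal (fun i => a + c * l i) = a • (1 : Matrix (Fin r) (Fin r) ℝ) +
        c • Matrix.diagonal l := by
      ext i j
      by_cases h : i = j <;> simp [Matrix.diagonal, h]
    rw [this, Matrix.mul_add, Matrix.add_mul, hFU]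
    simp [hU2]
  have hpow : ∀ (v : Fin r → ℝ) (T : ℕ), (U * Matrix.diagonal v * U.transpose) ^ T =
      U * Matrix.diagonal (fun i => v i ^ T) * U.transpose := by
    intro v T
    induction T with
    | zero => simp [hU2]
    | succ T ih =>
      rw [pow_succ, ih, hconj]
      rfl
  have htr : ∀ v : Fin r → ℝ, (U * Matrix.diagonal v * U.transpose).trace = ∑ i, v i := by
    intro v
    rw [Matrix.trace_mul_comm, ← Matrix.mul_assoc, hU1, Matrix.one_mul, Matrix.trace_diagonal]
  have hsub : b • (1 : Matrix (Fin r) (Fin r) ℝ) - F =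
      U * Matrix.diagonal (fun i => b - l i) * U.transpose := by
    have := hshift b (-1)
    simpa [sub_eq_add_neg] using this
  have hadd : ∀ a : ℝ, F + a • (1 : Matrix (Fin r) (Fin r) ℝ) =
      U * Matrix.diagonal (fun i => l i + a) * U.transpose := by
    intro a
    have := hshift a 1
    simpa [add_comm] using this
  have hdiag : ∀ v : Fin r → ℝ, (U * Matrix.diagonal v * U.transpose).PosSemidef →
      ∀ i, 0 ≤ v i := by
    intro v hv i
    have h := (hv.conjTranspose_mul_mul_same U).diag_nonneg (i := i)
    rw [Matrix.conjTranspose_eq_transpose_of_trivial] at h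
    have h2 : U.transpose * (U * Matrix.diagonal v * U.transpose) * U = Matrix.diagonal v := by
      calc _ = (U.transpose * U) * Matrix.diagonal v * (U.transpose * U) := by
            simp only [Matrix.mul_assoc]
        _ = _ := by rw [hU1, Matrix.one_mul, Matrix.mul_one]
    rw [h2] at h
    simpa using h
  have hl1 : ∀ i, l i ≤ b := fun i => by
    rw [hsub] at hF1
    linarith [hdiag _ hF1 i]
  have hl2 : ∀ i, -b ≤ l i := fun i => by
    rw [add_comm, hadd] at hF2
    linarith [hdiag _ hF2 i]
  have hQ' : (U.transpose * Q * U).PosSemidef := by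
    simpa [Matrix.conjTranspose_eq_transpose_of_trivial] using hQ.conjTranspose_mul_mul_same U
  have hQ'tr : ∑ i, (U.transpose * Q * U) i i ≤ t := by
    have h : (U.transpose * Q * U).trace = Q.trace := by
      rw [Matrix.trace_mul_comm, ← Matrix.mul_assoc, hU2, Matrix.one_mul]
    rw [← h] at hQt
    exact hQt
  have hQ'le : ∀ i, (U.transpose * Q * U) i i ≤ t := fun i =>
    le_trans (Finset.single_le_sum (f := fun i => (U.transpose * Q * U) i i)
      (fun i _ => hQ'.diag_nonneg) (Finset.mem_univ i)) hQ'tr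
  have hQF : (Q * F).trace + 2 * η * Q.trace =
      ∑ i, (U.transpose * Q * U) i i * (l i + 2 * η) := by
    have h1 : (Q * F).trace + 2 * η * Q.trace = (Q * (F + (2 * η) • 1)).trace := by
      rw [Matrix.mul_add, Matrix.trace_add, Matrix.mul_smul, Matrix.mul_one, Matrix.trace_smul,
        smul_eq_mul]
    rw [h1, hadd, ← Matrix.mul_assoc, Matrix.trace_mul_comm, ← Matrix.mul_assoc,
      ← Matrix.mul_assoc, Matrix.trace]
    refine Finset.sum_congr rfl fun i _ => ?_
    rw [Matrix.diag_apply, Matrix.mul_diagonal]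
  -- In the eigenbasis of F the diagonal entries of Q lie in [0, t], so Q can capture at most t
  -- times the negative part of F + 2η.
  have hmin : ∑ i, min 0 (l i + 2 * η) ≤ ((Q * F).trace + 2 * η * Q.trace) / t := by
    rw [le_div_iff₀ ht, hQF, Finset.sum_mul]
    refine Finset.sum_le_sum fun i _ => ?_
    have h0 : 0 ≤ (U.transpose * Q * U) i i := hQ'.diag_nonneg
    rcases le_total 0 (l i + 2 * η) with h | h
    · rw [min_eq_left h, zero_mul]
      exact mul_nonneg h0 h
    · rw [min_eq_right h, mul_comm]
      exact mul_le_mul_of_nonpos_right (hQ'le i) h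
  rw [hsub, hadd, hpow, hconj, hconj, htr]
  calc ∑ i, (b - l i) ^ T * (b - l i) ^ T * (l i + η)
      ≤ ∑ i, ((b + η) ^ (2 * T + 1) + (b + 2 * η) ^ (2 * T) * min 0 (l i + 2 * η)) :=
        Finset.sum_le_sum fun i _ => pow_shift_mul_le hη (hl1 i) (hl2 i) T
    _ = r * (b + η) ^ (2 * T + 1) + (b + 2 * η) ^ (2 * T) * ∑ i, min 0 (l i + 2 * η) := by
        rw [Finset.sum_add_distrib, ← Finset.mul_sum]
        simp
    _ ≤ _ := by
        rw [div_mul_eq_mul_div, mul_div_assoc]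
        have : 0 ≤ (b + 2 * η) ^ (2 * T) := by
          rw [pow_mul]
          positivity
        gcongr

/-! ### Planting along random graphs -/

/-- Overwrite `z` by `y` along the graph of `S`. -/
def plant {n q : ℕ} (S : Fin n → Fin q) (z : Fin n × Fin q → Bool) (y : Cube n) :
    Fin n × Fin q → Bool :=
  fun p => if p.2 = S p.1 then y p.1 else z p

/-- The restriction of `x` to the graph of `S`. -/
def alongGraph {n q : ℕ} (S : Fin n → Fin q) (x : Fin n × Fin q → Bool) : Cube n :=
  fun i => x (i, S i)

theorem alongGraph_plant {n q : ℕ} (S : Fin n → Fin q) (z : Fin n × Fin q → Bool) (y : Cube n) :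
    alongGraph S (plant S z y) = y := by
  ext i
  simp [alongGraph, plant]

theorem plant_plant_alongGraph {n q : ℕ} (S : Fin n → Fin q) (z : Fin n × Fin q → Bool)
    (y : Cube n) : plant S (plant S z y) (alongGraph S z) = z := by
  ext ⟨i, j⟩
  by_cases h : j = S i
  · subst h
    simp [plant, alongGraph]
  · simp [plant, h]

/-- Exchanging y with the values of z along the graph is an involution on pairs (z, y), so planting
a uniform y in a uniform z gives a uniform point. -/
theorem sum_plant {n q : ℕ} (S : Fin n → Fin q) (φ : (Fin n × Fin q → Bool) → ℝ) :
    ∑ z, ∑ y, φ (plant S z y) = 2 ^ n * ∑ x, φ x := by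
  have hinv : Function.Involutive (fun zy : (Fin n × Fin q → Bool) × Cube n =>
      (plant S zy.1 zy.2, alongGraph S zy.1)) := by
    rintro ⟨z, y⟩
    simp [plant_plant_alongGraph, alongGraph_plant]
  have h := Equiv.sum_comp hinv.toPerm (fun zy : (Fin n × Fin q → Bool) × Cube n => φ zy.1)
  simp only [Function.Involutive.coe_toPerm] at h
  rw [Fintype.sum_prod_type, Fintype.sum_prod_type] at h
  rw [h]
  simp [Finset.mul_sum]

/-- The number of points of `A` on the graph of `S`. -/
def meetCard {n q : ℕ} (S : Fin n → Fin q) (A : Finset (Fin n × Fin q)) : ℕ :=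
  (A.filter fun p => p.2 = S p.1).card

theorem walsh_plant_mem_lowDegree {n q h : ℕ} (S : Fin n → Fin q) (z : Fin n × Fin q → Bool)
    {A : Finset (Fin n × Fin q)} (hA : meetCard S A ≤ h) :
    (fun y => walsh A (plant S z y)) ∈ lowDegree (Fin n) h := by
  have heq : (fun y => walsh A (plant S z y)) =
      (∏ p ∈ A.filter (fun p => ¬ p.2 = S p.1), boolSign (z p)) •
        ∏ p ∈ A.filter (fun p => p.2 = S p.1), (fun y : Cube n => boolSign (y p.1)) := by
    ext y
    rw [walsh, ← Finset.prod_filter_mul_prod_filter_not A (fun p => p.2 = S p.1), mul_comm]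
    simp only [Pi.smul_apply, Finset.prod_apply, smul_eq_mul]
    congr 1
    · refine Finset.prod_congr rfl fun p hp => ?_
      rw [plant, if_neg (Finset.mem_filter.mp hp).2]
    · refine Finset.prod_congr rfl fun p hp => ?_
      rw [plant, if_pos (Finset.mem_filter.mp hp).2]
  rw [heq]
  exact Submodule.smul_mem _ _ (lowDegree_mono hA
    (prod_mem_lowDegree _ _ fun p _ => boolSign_mem_lowDegree p.1))

/-- Resample x as `plant S z y`: for each fixed z the sum over y tests D against a square of degree
at most h in each factor. -/
theorem sum_pseudoDensity_mul_sq_nonneg {n q h : ℕ} (S : Fin n → Fin q) {D : Cube n → ℝ}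
    (hD : ∀ g ∈ lowDegree (Fin n) h, 0 ≤ ∑ y, D y * g y ^ 2) (g : (Fin n × Fin q → Bool) → ℝ)
    (hg : ∀ z, (fun y => g (plant S z y)) ∈ lowDegree (Fin n) h) :
    0 ≤ ∑ x, D (alongGraph S x) * g x ^ 2 := by
  have h1 := sum_plant S (fun x => D (alongGraph S x) * g x ^ 2)
  simp only [alongGraph_plant] at h1
  have h2 : 0 ≤ ∑ z, ∑ y, D y * g (plant S z y) ^ 2 :=
    Finset.sum_nonneg fun z _ => hD _ (hg z)
  rw [h1] at h2
  exact nonneg_of_mul_nonneg_right h2 (by positivity)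

/-- If some graph contains E, then E has at most one point in each block, and S is forced in |E| of
its n coordinates; otherwise the count is zero. -/
theorem card_graph_superset_mul_le {n q : ℕ} (E : Finset (Fin n × Fin q)) :
    (Finset.univ.filter fun S : Fin n → Fin q => ∀ p ∈ E, p.2 = S p.1).card * q ^ E.card ≤
      q ^ n := by
  classical
  set G := Finset.univ.filter fun S : Fin n → Fin q => ∀ p ∈ E, p.2 = S p.1 with hG
  rcases G.eq_empty_or_nonempty with h0 | ⟨S₀, hS₀⟩
  · simp [h0]
  have hS₀ : ∀ p ∈ E, p.2 = S₀ p.1 := by simpa [hG] using hS₀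
  set J := E.image Prod.fst with hJ
  have hJcard : J.card = E.card := by
    refine Finset.card_image_of_injOn fun p hp p' hp' h => ?_
    exact Prod.ext h (by rw [hS₀ p hp, hS₀ p' hp', h])
  have hsub : G ⊆ Fintype.piFinset fun i => if i ∈ J then {S₀ i} else Finset.univ := by
    intro S hS
    have hS : ∀ p ∈ E, p.2 = S p.1 := by simpa [hG] using hS
    rw [Fintype.mem_piFinset]
    intro i
    split_ifs with hi
    · obtain ⟨p, hp, rfl⟩ := Finset.mem_image.mp hi
      rw [Finset.mem_singleton, ← hS p hp, hS₀ p hp]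
    · exact Finset.mem_univ _
  have hcard : G.card ≤ q ^ (n - J.card) := by
    refine (Finset.card_le_card hsub).trans (le_of_eq ?_)
    rw [Fintype.card_piFinset]
    have : ∀ i, (if i ∈ J then {S₀ i} else (Finset.univ : Finset (Fin q))).card =
        if i ∈ J then 1 else q := by
      intro i
      split_ifs <;> simp
    simp_rw [this]
    rw [Finset.prod_ite]
    simp only [Finset.prod_const_one, one_mul, Finset.prod_const]
    congr 1
    rw [Finset.filter_not, Finset.card_sdiff_of_subset (Finset.filter_subset _ _)]
    simp
  have hJn : J.card ≤ n := by simpa using Finset.card_le_univ J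
  calc G.card * q ^ E.card ≤ q ^ (n - J.card) * q ^ E.card := Nat.mul_le_mul_right _ hcard
    _ = q ^ n := by rw [← pow_add, ← hJcard, Nat.sub_add_cancel hJn]

/-- Few graphs meet a given small set in many points. -/
theorem card_meetCard_mul_le {n q : ℕ} (A : Finset (Fin n × Fin q)) (m : ℕ) :
    (Finset.univ.filter fun S : Fin n → Fin q => m ≤ meetCard S A).card * q ^ m ≤
      A.card ^ m * q ^ n := by
  classical
  have hsub : (Finset.univ.filter fun S : Fin n → Fin q => m ≤ meetCard S A) ⊆
      (Finset.powersetCard m A).biUnion fun E =>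
        Finset.univ.filter fun S : Fin n → Fin q => ∀ p ∈ E, p.2 = S p.1 := by
    intro S hS
    have hS : m ≤ (A.filter fun p => p.2 = S p.1).card := (Finset.mem_filter.mp hS).2
    obtain ⟨E, hE, hEc⟩ := Finset.exists_subset_card_eq hS
    simp only [Finset.mem_biUnion, Finset.mem_powersetCard, Finset.mem_filter, Finset.mem_univ,
      true_and]
    exact ⟨E, ⟨hE.trans (Finset.filter_subset _ _), hEc⟩,
      fun p hp => (Finset.mem_filter.mp (hE hp)).2⟩
  calc _ ≤ (∑ E ∈ Finset.powersetCard m A,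
        (Finset.univ.filter fun S : Fin n → Fin q => ∀ p ∈ E, p.2 = S p.1).card) * q ^ m :=
        Nat.mul_le_mul_right _ ((Finset.card_le_card hsub).trans Finset.card_biUnion_le)
    _ = ∑ E ∈ Finset.powersetCard m A,
        (Finset.univ.filter fun S : Fin n → Fin q => ∀ p ∈ E, p.2 = S p.1).card * q ^ m :=
        Finset.sum_mul _ _ _
    _ ≤ ∑ E ∈ Finset.powersetCard m A, q ^ n := Finset.sum_le_sum fun E hE => by
        have := card_graph_superset_mul_le E
        rwa [(Finset.mem_powersetCard.mp hE).2] at this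
    _ = (A.card.choose m) * q ^ n := by simp
    _ ≤ A.card ^ m * q ^ n := Nat.mul_le_mul_right _ (Nat.choose_le_pow _ _)

/-- A random restriction kills most of the part of large degree. -/
theorem sum_highPart_sq_le {n q l m : ℕ} (a : Finset (Fin n × Fin q) → ℝ)
    (ha : ∀ A, l < A.card → a A = 0) :
    (q : ℝ) ^ m * ∑ S : Fin n → Fin q, ∑ x : Fin n × Fin q → Bool,
        (∑ A, (if m ≤ meetCard S A then a A else 0) * walsh A x) ^ 2 ≤
      (l : ℝ) ^ m * q ^ n * ∑ x : Fin n × Fin q → Bool, (∑ A, a A * walsh A x) ^ 2 := by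
  -- By Parseval it suffices to bound, for each A with |A| ≤ l, the proportion of graphs meeting A
  -- in at least m points by (l/q)^m.
  simp_rw [sum_sq_walsh]
  rw [← Finset.mul_sum, Finset.sum_comm, mul_left_comm, mul_left_comm _ ((2 : ℝ) ^ _)]
  refine mul_le_mul_of_nonneg_left ?_ (by positivity)
  rw [Finset.mul_sum, Finset.mul_sum]
  refine Finset.sum_le_sum fun A _ => ?_
  have h1 : ∑ S : Fin n → Fin q, (if m ≤ meetCard S A then a A else 0) ^ 2 =
      (Finset.univ.filter fun S : Fin n → Fin q => m ≤ meetCard S A).card * a A ^ 2 := by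
    simp_rw [ite_pow, zero_pow two_ne_zero]
    rw [← Finset.sum_filter]
    simp
  rw [h1]
  by_cases hA : l < A.card
  · simp [ha A hA]
  · have h2 : ((Finset.univ.filter fun S : Fin n → Fin q => m ≤ meetCard S A).card : ℝ) * q ^ m ≤
        (A.card : ℝ) ^ m * q ^ n := by exact_mod_cast card_meetCard_mul_le A m
    have h3 : (A.card : ℝ) ^ m * (q : ℝ) ^ n ≤ (l : ℝ) ^ m * q ^ n := by
      have : (A.card : ℝ) ≤ l := by exact_mod_cast not_lt.mp hA
      gcongr
    nlinarith [sq_nonneg (a A)]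

/-! ### Planted pseudo-densities against matrix squares -/

theorem sum_comm_two_two {α β γ κ : Type*} [Fintype α] [Fintype β] [Fintype γ] [Fintype κ]
    (f : α → β → γ → κ → ℝ) :
    ∑ a, ∑ b, ∑ c, ∑ e, f a b c e = ∑ c, ∑ e, ∑ a, ∑ b, f a b c e := by
  calc _ = ∑ p : α × β, ∑ c, ∑ e, f p.1 p.2 c e := by rw [Fintype.sum_prod_type]
    _ = ∑ c, ∑ p : α × β, ∑ e, f p.1 p.2 c e := Finset.sum_comm
    _ = ∑ c, ∑ e, ∑ p : α × β, f p.1 p.2 c e := Finset.sum_congr rfl fun c _ => Finset.sum_comm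
    _ = _ := by simp_rw [Fintype.sum_prod_type]

theorem sum_mul_sq_le {r : ℕ} (C H : Matrix (Fin r) (Fin r) ℝ) :
    ∑ i, ∑ j, (C * H) i j ^ 2 ≤ (∑ i, ∑ j, C i j ^ 2) * ∑ i, ∑ j, H i j ^ 2 := by
  have h : ∀ i j, (C * H) i j ^ 2 ≤ (∑ k, C i k ^ 2) * ∑ k, H k j ^ 2 := fun i j => by
    rw [Matrix.mul_apply]
    exact Finset.sum_mul_sq_le_sq_mul_sq _ _ _
  calc ∑ i, ∑ j, (C * H) i j ^ 2 ≤ ∑ i, ∑ j, (∑ k, C i k ^ 2) * ∑ k, H k j ^ 2 :=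
        Finset.sum_le_sum fun i _ => Finset.sum_le_sum fun j _ => h i j
    _ = _ := by
        rw [Finset.sum_comm (f := fun i j => H i j ^ 2), Finset.sum_mul_sum]

theorem trace_transpose_mul_self {r : ℕ} (H : Matrix (Fin r) (Fin r) ℝ) :
    (H.transpose * H).trace = ∑ i, ∑ j, H i j ^ 2 := by
  rw [Matrix.trace, Finset.sum_comm]
  refine Finset.sum_congr rfl fun j _ => ?_
  rw [Matrix.diag_apply, Matrix.mul_apply]
  exact Finset.sum_congr rfl fun i _ => by rw [Matrix.transpose_apply, sq]

/-- Since D may be negative, replacing a by a + b costs |D| |2(a+b)b - b²|; the cross term is split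
by the weighted AM-GM inequality. The first error is charged to a + b, which is the full polynomial
in the application, and only the second to the small part b. -/
theorem mul_sq_add_ge {D B θ a b : ℝ} (hD : |D| ≤ B) (hθ : 0 < θ) :
    D * a ^ 2 - B * (θ * (a + b) ^ 2 + (1 / θ + 1) * b ^ 2) ≤ D * (a + b) ^ 2 := by
  have hB : 0 ≤ B := (abs_nonneg D).trans hD
  have h1 : |2 * (a + b) * b - b ^ 2| ≤ θ * (a + b) ^ 2 + (1 / θ + 1) * b ^ 2 := by
    have h2 : 0 ≤ (θ * (a + b) - b) ^ 2 / θ := by positivity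
    have h3 : 0 ≤ (θ * (a + b) + b) ^ 2 / θ := by positivity
    have h4 : (θ * (a + b) - b) ^ 2 / θ =
        θ * (a + b) ^ 2 - 2 * (a + b) * b + 1 / θ * b ^ 2 := by
      field_simp
      ring
    have h5 : (θ * (a + b) + b) ^ 2 / θ =
        θ * (a + b) ^ 2 + 2 * (a + b) * b + 1 / θ * b ^ 2 := by
      field_simp
      ring
    rw [abs_le]
    constructor <;> nlinarith [sq_nonneg b]
  have h6 : |D * (2 * (a + b) * b - b ^ 2)| ≤ B * (θ * (a + b) ^ 2 + (1 / θ + 1) * b ^ 2) := by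
    rw [abs_mul]
    exact mul_le_mul hD h1 (abs_nonneg _) hB
  have h7 := (abs_le.mp h6).1
  nlinarith

/-- Pseudo-densities planted along random graphs are almost nonnegative on squares of
matrix polynomials of low degree. -/
theorem sum_pseudoDensity_trace_ge {n q r h l : ℕ} (hq : 0 < q) {D : Cube n → ℝ} {B τ θ : ℝ}
    (hDB : ∀ y, |D y| ≤ B) (hD : ∀ g ∈ lowDegree (Fin n) h, 0 ≤ ∑ y, D y * g y ^ 2)
    (P : (Fin n → Fin q) → Matrix (Fin r) (Fin r) ℝ) (hP : ∀ S, (P S).PosSemidef)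
    (hsum : (((q : ℝ) ^ n) • (1 : Matrix (Fin r) (Fin r) ℝ) - ∑ S, P S).PosSemidef)
    (hτ : ∀ S, (P S).trace ≤ τ) (hθ : 0 < θ)
    (R : (Fin n × Fin q → Bool) → Matrix (Fin r) (Fin r) ℝ)
    (hR : ∀ i j, (fun x => R x i j) ∈ lowDegree (Fin n × Fin q) l) :
    -(B * (θ + (1 / θ + 1) * (τ * ((l : ℝ) / q) ^ (h + 1))) * (q : ℝ) ^ n *
        ∑ x, ((R x).transpose * R x).trace) ≤
      ∑ x, ∑ S, D (alongGraph S x) * ((R x).transpose * P S * R x).trace := by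
  choose C hC using fun S => (hP S).exists_transpose_mul_self
  choose a ha haR using fun i j => exists_walsh_coeff (hR i j)
  have hB : 0 ≤ B := (abs_nonneg _).trans (hDB fun _ => false)
  -- For each S, split the Walsh expansion of R by whether a character meets the graph of S in at
  -- most h points (`Lo`) or in more (`Hi`).
  let Lo : (Fin n → Fin q) → (Fin n × Fin q → Bool) → Matrix (Fin r) (Fin r) ℝ :=
    fun S x => Matrix.of fun i j => ∑ A, (if h + 1 ≤ meetCard S A then 0 else a i j A) * walsh A x
  let Hi : (Fin n → Fin q) → (Fin n × Fin q → Bool) → Matrix (Fin r) (Fin r) ℝ :=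
    fun S x => Matrix.of fun i j => ∑ A, (if h + 1 ≤ meetCard S A then a i j A else 0) * walsh A x
  have hsplit : ∀ S x, R x = Lo S x + Hi S x := by
    intro S x
    ext i j
    change _ = (∑ A, (if h + 1 ≤ meetCard S A then 0 else a i j A) * walsh A x) +
      ∑ A, (if h + 1 ≤ meetCard S A then a i j A else 0) * walsh A x
    rw [haR i j x, ← Finset.sum_add_distrib]
    refine Finset.sum_congr rfl fun A _ => ?_
    split_ifs <;> ring
  have htrace : ∀ S x, ((R x).transpose * P S * R x).trace = ∑ i, ∑ j, (C S * R x) i j ^ 2 := by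
    intro S x
    rw [← trace_transpose_mul_self, Matrix.transpose_mul, hC S]
    simp only [Matrix.mul_assoc]
  have hlow : ∀ S i j, 0 ≤ ∑ x, D (alongGraph S x) * (C S * Lo S x) i j ^ 2 := by
    intro S i j
    refine sum_pseudoDensity_mul_sq_nonneg S hD (fun x => (C S * Lo S x) i j) fun z => ?_
    have : (fun y => (C S * Lo S (plant S z y)) i j) = ∑ k, C S i k • ∑ A,
        (if h + 1 ≤ meetCard S A then 0 else a k j A) • fun y => walsh A (plant S z y) := by
      ext y
      rw [Matrix.mul_apply, Finset.sum_apply]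
      refine Finset.sum_congr rfl fun k _ => ?_
      rw [Pi.smul_apply, smul_eq_mul, Finset.sum_apply]
      rfl
    rw [this]
    refine Submodule.sum_mem _ fun k _ => Submodule.smul_mem _ _
      (Submodule.sum_mem _ fun A _ => ?_)
    split_ifs with hA
    · simp
    · exact Submodule.smul_mem _ _ (walsh_plant_mem_lowDegree S z (by omega))
  have hpoint : ∀ S x, ∑ i, ∑ j, D (alongGraph S x) * (C S * Lo S x) i j ^ 2 -
      B * (θ * ((R x).transpose * P S * R x).trace +
        (1 / θ + 1) * (τ * ∑ i, ∑ j, Hi S x i j ^ 2)) ≤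
      D (alongGraph S x) * ((R x).transpose * P S * R x).trace := by
    intro S x
    -- Here the individual bound τ on tr P_S is needed: `Hi` depends on S, so the bound on the sum
    -- of the P_S does not apply.
    have hHi : ∑ i, ∑ j, (C S * Hi S x) i j ^ 2 ≤ τ * ∑ i, ∑ j, Hi S x i j ^ 2 := by
      refine (sum_mul_sq_le _ _).trans (mul_le_mul_of_nonneg_right ?_ (by positivity))
      rw [← trace_transpose_mul_self, ← hC S]
      exact hτ S
    have h1 : ∑ i, ∑ j, D (alongGraph S x) * (C S * Lo S x) i j ^ 2 -
        B * (θ * ∑ i, ∑ j, (C S * R x) i j ^ 2 +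
          (1 / θ + 1) * ∑ i, ∑ j, (C S * Hi S x) i j ^ 2) ≤
        D (alongGraph S x) * ∑ i, ∑ j, (C S * R x) i j ^ 2 := by
      simp only [Finset.mul_sum, ← Finset.sum_add_distrib, ← Finset.sum_sub_distrib]
      refine Finset.sum_le_sum fun i _ => Finset.sum_le_sum fun j _ => ?_
      have hs : (C S * R x) i j = (C S * Lo S x) i j + (C S * Hi S x) i j := by
        rw [hsplit S x, Matrix.mul_add, Matrix.add_apply]
      rw [hs]
      exact mul_sq_add_ge (hDB _) hθ
    rw [htrace]
    refine le_trans ?_ h1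
    have hθ' : 0 ≤ 1 / θ + 1 := by positivity
    gcongr
  have hHisum : ∑ S, ∑ x, ∑ i, ∑ j, Hi S x i j ^ 2 ≤
      ((l : ℝ) / q) ^ (h + 1) * (q : ℝ) ^ n * ∑ x, ((R x).transpose * R x).trace := by
    have hq' : (0 : ℝ) < (q : ℝ) ^ (h + 1) := by positivity
    have h1 : ∀ i j, (q : ℝ) ^ (h + 1) * ∑ S, ∑ x, Hi S x i j ^ 2 ≤
        (l : ℝ) ^ (h + 1) * q ^ n * ∑ x, R x i j ^ 2 := by
      intro i j
      have := sum_highPart_sq_le (m := h + 1) (a i j) (ha i j)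
      simp only [← haR i j] at this
      exact this
    have h2 : ∑ S, ∑ x, ∑ i, ∑ j, Hi S x i j ^ 2 = ∑ i, ∑ j, ∑ S, ∑ x, Hi S x i j ^ 2 :=
      sum_comm_two_two fun S x i j => Hi S x i j ^ 2
    have h3 : ∑ x, ((R x).transpose * R x).trace = ∑ i, ∑ j, ∑ x, R x i j ^ 2 := by
      simp_rw [trace_transpose_mul_self]
      rw [Finset.sum_comm]
      exact Finset.sum_congr rfl fun i _ => Finset.sum_comm
    rw [h2, h3, div_pow, div_mul_eq_mul_div, div_mul_eq_mul_div, le_div_iff₀ hq', mul_comm,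
      Finset.mul_sum, Finset.mul_sum]
    refine Finset.sum_le_sum fun i _ => ?_
    rw [Finset.mul_sum, Finset.mul_sum]
    exact Finset.sum_le_sum fun j _ => h1 i j
  have hPsum : ∑ S, ∑ x, ((R x).transpose * P S * R x).trace ≤
      (q : ℝ) ^ n * ∑ x, ((R x).transpose * R x).trace := by
    rw [Finset.sum_comm, Finset.mul_sum]
    refine Finset.sum_le_sum fun x _ => ?_
    have h1 := (hsum.conjTranspose_mul_mul_same (R x)).trace_nonneg
    rw [Matrix.conjTranspose_eq_transpose_of_trivial, Matrix.mul_sub, Matrix.sub_mul,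
      Matrix.trace_sub, Matrix.mul_smul, Matrix.smul_mul, Matrix.mul_one, Matrix.trace_smul,
      Matrix.mul_sum, Matrix.sum_mul, Matrix.trace_sum, smul_eq_mul] at h1
    linarith
  have hτ0 : 0 ≤ τ := (hP fun _ => ⟨0, hq⟩).trace_nonneg.trans (hτ _)
  rw [Finset.sum_comm]
  calc _ ≤ ∑ S, ∑ x, (∑ i, ∑ j, D (alongGraph S x) * (C S * Lo S x) i j ^ 2) -
        B * (θ * ∑ S, ∑ x, ((R x).transpose * P S * R x).trace +
        (1 / θ + 1) * (τ * ∑ S, ∑ x, ∑ i, ∑ j, Hi S x i j ^ 2)) := by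
        have h1 : 0 ≤ ∑ S, ∑ x, (∑ i, ∑ j, D (alongGraph S x) * (C S * Lo S x) i j ^ 2) := by
          refine Finset.sum_nonneg fun S _ => ?_
          rw [Finset.sum_comm]
          refine Finset.sum_nonneg fun i _ => ?_
          rw [Finset.sum_comm]
          exact Finset.sum_nonneg fun j _ => hlow S i j
        have h2 : B * (θ * ∑ S, ∑ x, ((R x).transpose * P S * R x).trace +
            (1 / θ + 1) * (τ * ∑ S, ∑ x, ∑ i, ∑ j, Hi S x i j ^ 2)) ≤
            B * (θ * ((q : ℝ) ^ n * ∑ x, ((R x).transpose * R x).trace) +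
            (1 / θ + 1) * (τ * (((l : ℝ) / q) ^ (h + 1) * (q : ℝ) ^ n *
              ∑ x, ((R x).transpose * R x).trace))) := by
          have hθ' : 0 ≤ 1 / θ + 1 := by positivity
          gcongr
        linarith
    _ ≤ _ := by
        simp only [Finset.mul_sum, ← Finset.sum_add_distrib, ← Finset.sum_sub_distrib] at hpoint ⊢
        exact Finset.sum_le_sum fun S _ => Finset.sum_le_sum fun x _ => hpoint S x

theorem matrix_pow_entry_mem_lowDegree {ι : Type*} [DecidableEq ι] {r e : ℕ}
    (G : (ι → Bool) → Matrix (Fin r) (Fin r) ℝ)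
    (hG : ∀ i j, (fun x => G x i j) ∈ lowDegree ι e) (T : ℕ) (i j : Fin r) :
    (fun x => (G x ^ T) i j) ∈ lowDegree ι (e * T) := by
  induction T generalizing i j with
  | zero =>
    simp only [pow_zero]
    exact const_mem_lowDegree _ _
  | succ T ih =>
    have h : (fun x => (G x ^ (T + 1)) i j) =
        ∑ k, (fun x => (G x ^ T) i k) * fun x => G x k j := by
      ext x
      rw [pow_succ, Matrix.mul_apply, Finset.sum_apply]
      rfl
    rw [h, mul_add, mul_one]
    exact Submodule.sum_mem _ fun k _ => mul_mem_lowDegree (ih i k) (hG k j)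

/-! ### Contradiction from a small factorization -/

/-- Discard the left factors of large trace. -/
theorem exists_truncated_factors {r : ℕ} {σ : Type*} [Fintype σ] (hr : 0 < r)
    (P : σ → Matrix (Fin r) (Fin r) ℝ) (hP : ∀ S, (P S).PosSemidef) {M κ : ℝ}
    (hsum : (M • (1 : Matrix (Fin r) (Fin r) ℝ) - ∑ S, P S).PosSemidef) (hκ : 0 < κ) :
    ∃ (P' : σ → Matrix (Fin r) (Fin r) ℝ) (bad : Finset σ), (∀ S, (P' S).PosSemidef) ∧
      (∀ S, (P' S).trace ≤ r * κ) ∧ (∀ S ∈ bad, P' S = 0) ∧ (∀ S ∉ bad, P' S = P S) ∧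
      (M • (1 : Matrix (Fin r) (Fin r) ℝ) - ∑ S, P' S).PosSemidef ∧ bad.card * κ ≤ M := by
  classical
  have hr' : (0 : ℝ) < r := by exact_mod_cast hr
  refine ⟨fun S => if (P S).trace ≤ r * κ then P S else 0,
    Finset.univ.filter fun S => ¬ (P S).trace ≤ r * κ, fun S => ?_, fun S => ?_, fun S hS => ?_,
    fun S hS => ?_, ?_, ?_⟩
  · dsimp only
    split_ifs
    exacts [hP S, Matrix.PosSemidef.zero]
  · dsimp only
    split_ifs with h
    · exact h
    · simp only [Matrix.trace_zero]
      positivity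
  · exact if_neg (Finset.mem_filter.mp hS).2
  · exact if_pos (by simpa using hS)
  · have h : M • (1 : Matrix (Fin r) (Fin r) ℝ) - ∑ S, (if (P S).trace ≤ r * κ then P S else 0) =
        (M • 1 - ∑ S, P S) + ∑ S, (if (P S).trace ≤ r * κ then 0 else P S) := by
      have : ∑ S, P S = ∑ S, (if (P S).trace ≤ r * κ then P S else 0) +
          ∑ S, (if (P S).trace ≤ r * κ then 0 else P S) := by
        rw [← Finset.sum_add_distrib]
        refine Finset.sum_congr rfl fun S _ => ?_
        split_ifs <;> simp
      rw [this]
      abel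
    rw [h]
    refine hsum.add (Matrix.posSemidef_sum _ fun S _ => ?_)
    split_ifs
    exacts [Matrix.PosSemidef.zero, hP S]
  · have h1 : ∑ S, (P S).trace ≤ M * r := by
      have := hsum.trace_nonneg
      rw [Matrix.trace_sub, Matrix.trace_smul, Matrix.trace_one, Matrix.trace_sum,
        Fintype.card_fin, smul_eq_mul] at this
      linarith
    set bad := Finset.univ.filter fun S => ¬ (P S).trace ≤ r * κ with hbad
    -- Markov's inequality: the traces sum to at most M r, so at most M/κ of them exceed r κ.
    have h2 : (bad.card : ℝ) * (r * κ) ≤ ∑ S, (P S).trace := by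
      calc (bad.card : ℝ) * (r * κ) = ∑ _S ∈ bad, r * κ := by simp
        _ ≤ ∑ S ∈ bad, (P S).trace :=
          Finset.sum_le_sum fun S hS => (not_le.mp (Finset.mem_filter.mp hS).2).le
        _ ≤ ∑ S, (P S).trace := Finset.sum_le_sum_of_subset_of_nonneg (Finset.subset_univ _)
          fun S _ _ => (hP S).trace_nonneg
    have h3 : (bad.card * κ) * r ≤ M * r := by linarith
    exact le_of_mul_le_mul_right h3 hr'

/-- A bounded pseudo-density planted along random graphs obstructs small factorizations: version
for factors in normalized form. -/
theorem not_normalized_factorization {n q r h T : ℕ} (hq : 0 < q) {D : Cube n → ℝ}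
    {B τ θ η : ℝ} (hDB : ∀ y, |D y| ≤ B)
    (hD : ∀ g ∈ lowDegree (Fin n) h, 0 ≤ ∑ y, D y * g y ^ 2)
    (P : (Fin n → Fin q) → Matrix (Fin r) (Fin r) ℝ)
    (Q : (Fin n × Fin q → Bool) → Matrix (Fin r) (Fin r) ℝ)
    (hP : ∀ S, (P S).PosSemidef) (hQ : ∀ x, (Q x).PosSemidef)
    (hsum : (((q : ℝ) ^ n) • (1 : Matrix (Fin r) (Fin r) ℝ) - ∑ S, P S).PosSemidef)
    (hτ : ∀ S, (P S).trace ≤ τ) (hQt : ∀ x, (Q x).trace ≤ 3) (hθ : 0 < θ) (hη : 0 < η)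
    (hneg : ∑ x, ∑ S, D (alongGraph S x) * frobInner (P S) (Q x) ≤
      -(12 * η) * (q : ℝ) ^ n * 2 ^ (n * q))
    (hT : r * (B + η) ^ (2 * T + 1) < 2 * η * (B + 2 * η) ^ (2 * T))
    (hl : B * (θ + (1 / θ + 1) * (τ * (((n * T : ℕ) : ℝ) / q) ^ (h + 1))) ≤ η) : False := by
  set M : ℝ := (q : ℝ) ^ n with hM
  have hM0 : 0 < M := by positivity
  -- The average over S of D(x_S) P_S; each D(x_S) depends on n bits, so the entries of F have
  -- degree at most n.
  let F : (Fin n × Fin q → Bool) → Matrix (Fin r) (Fin r) ℝ :=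
    fun x => M⁻¹ • ∑ S, D (alongGraph S x) • P S
  have hFh : ∀ x, (F x).IsHermitian := by
    intro x
    rw [Matrix.IsHermitian, Matrix.conjTranspose_eq_transpose_of_trivial, Matrix.transpose_smul,
      Matrix.transpose_sum]
    simp_rw [Matrix.transpose_smul, (hP _).transpose_eq]
    rfl
  have hbound : ∀ (x) (σ : ℝ), (∀ y, 0 ≤ B - σ * D y) →
      (B • (1 : Matrix (Fin r) (Fin r) ℝ) - σ • F x).PosSemidef := by
    intro x σ hσ
    have hB : 0 ≤ B := (abs_nonneg _).trans (hDB fun _ => false)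
    -- Written as a combination of positive semidefinite matrices: the slack of the normalization,
    -- and the P_S with nonnegative coefficients B - σ D.
    have h : B • (1 : Matrix (Fin r) (Fin r) ℝ) - σ • F x =
        M⁻¹ • (B • (M • (1 : Matrix (Fin r) (Fin r) ℝ) - ∑ S, P S) +
          ∑ S, (B - σ * D (alongGraph S x)) • P S) := by
      simp only [F, sub_smul, Finset.sum_sub_distrib, smul_sub, smul_add, Finset.smul_sum,
        smul_smul]
      rw [← mul_assoc, mul_comm _ B, mul_assoc, inv_mul_cancel₀ hM0.ne', mul_one]
      have hc : ∀ S, M⁻¹ * (σ * D (alongGraph S x)) = σ * (M⁻¹ * D (alongGraph S x)) :=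
        fun S => by ring
      simp only [hc]
      abel
    rw [h]
    exact (((hsum.smul hB)).add (Matrix.posSemidef_sum _ fun S _ => (hP S).smul (hσ _))).smul
      (inv_nonneg.mpr hM0.le)
  have hF1 : ∀ x, (B • (1 : Matrix (Fin r) (Fin r) ℝ) - F x).PosSemidef := fun x => by
    simpa using hbound x 1 fun y => by linarith [(abs_le.mp (hDB y)).2]
  have hF2 : ∀ x, (B • (1 : Matrix (Fin r) (Fin r) ℝ) + F x).PosSemidef := fun x => by
    simpa using hbound x (-1) fun y => by linarith [(abs_le.mp (hDB y)).1]
  set R : (Fin n × Fin q → Bool) → Matrix (Fin r) (Fin r) ℝ := fun x => (B • 1 - F x) ^ T with hR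
  have hRt : ∀ x, (R x).transpose = R x := by
    intro x
    rw [hR, Matrix.transpose_pow, (hF1 x).transpose_eq]
  have hRdeg : ∀ i j, (fun x => R x i j) ∈ lowDegree (Fin n × Fin q) (n * T) := by
    refine matrix_pow_entry_mem_lowDegree _ (fun i j => ?_) T
    have h : (fun x => (B • (1 : Matrix (Fin r) (Fin r) ℝ) - F x) i j) =
        (fun _ => (B • (1 : Matrix (Fin r) (Fin r) ℝ)) i j) -
          M⁻¹ • ∑ S, P S i j • fun x : Fin n × Fin q → Bool => D (alongGraph S x) := by
      ext x
      simp [F, Matrix.sum_apply, mul_comm]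
    rw [h]
    exact Submodule.sub_mem _ (const_mem_lowDegree _ _) (Submodule.smul_mem _ _
      (Submodule.sum_mem _ fun S _ => Submodule.smul_mem _ _
        (junta_mem_lowDegree D fun i => (i, S i))))
  have hQF : ∑ x, (Q x * F x).trace ≤ -(12 * η) * 2 ^ (n * q) := by
    have h : ∑ x, (Q x * F x).trace =
        M⁻¹ * ∑ x, ∑ S, D (alongGraph S x) * frobInner (P S) (Q x) := by
      rw [Finset.mul_sum]
      refine Finset.sum_congr rfl fun x _ => ?_
      simp only [F, Matrix.mul_smul, Matrix.trace_smul, Matrix.mul_sum, Matrix.trace_sum,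
        smul_eq_mul]
      congr 1
      refine Finset.sum_congr rfl fun S _ => ?_
      rw [frobInner, (hP S).transpose_eq, Matrix.trace_mul_comm]
    rw [h, inv_mul_le_iff₀ hM0]
    linarith
  have hcard : (Fintype.card (Fin n × Fin q → Bool) : ℝ) = 2 ^ (n * q) := by simp
  have hup : ∑ x, (R x * R x * (F x + η • 1)).trace < 0 := by
    have h1 : ∀ x, (R x * R x * (F x + η • 1)).trace ≤ r * (B + η) ^ (2 * T + 1) +
        (B + 2 * η) ^ (2 * T) / 3 * ((Q x * F x).trace + 2 * η * (Q x).trace) := fun x =>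
      trace_pow_shift_mul_le hη (by norm_num) (hFh x) (hF1 x) (hF2 x) (hQ x) (hQt x) T
    refine (Finset.sum_le_sum fun x _ => h1 x).trans_lt ?_
    rw [Finset.sum_add_distrib, Finset.sum_const, Finset.card_univ, nsmul_eq_mul, hcard,
      ← Finset.mul_sum, Finset.sum_add_distrib, ← Finset.mul_sum]
    have h2 : ∑ x, (Q x).trace ≤ 3 * 2 ^ (n * q) := by
      calc ∑ x, (Q x).trace ≤ ∑ _x : Fin n × Fin q → Bool, (3 : ℝ) :=
            Finset.sum_le_sum fun x _ => hQt x
        _ = 3 * 2 ^ (n * q) := by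
            rw [Finset.sum_const, Finset.card_univ, nsmul_eq_mul, hcard, mul_comm]
    have h3 : 0 ≤ (B + 2 * η) ^ (2 * T) / 3 := by
      rw [pow_mul]
      positivity
    -- On average -12η + 2η · 3 = -6η; division by the trace bound 3 leaves the -2η that `hT` is
    -- matched to.
    have h4 : ∑ x, (Q x * F x).trace + 2 * η * ∑ x, (Q x).trace ≤ -(6 * η) * 2 ^ (n * q) := by
      nlinarith
    have h5 := mul_le_mul_of_nonneg_left h4 h3
    have h6 : (0 : ℝ) < 2 ^ (n * q) := by positivity
    have h7 := mul_lt_mul_of_pos_left hT h6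
    nlinarith
  have hlow := sum_pseudoDensity_trace_ge hq hDB hD P hP hsum hτ hθ R hRdeg
  have heq : ∑ x, ∑ S, D (alongGraph S x) * ((R x).transpose * P S * R x).trace =
      M * ∑ x, (R x * R x * F x).trace := by
    rw [Finset.mul_sum]
    refine Finset.sum_congr rfl fun x _ => ?_
    simp only [F, Matrix.mul_smul, Matrix.trace_smul, Matrix.mul_sum, Matrix.trace_sum,
      smul_eq_mul, hRt]
    rw [← mul_assoc, mul_inv_cancel₀ hM0.ne', one_mul]
    refine Finset.sum_congr rfl fun S _ => ?_
    rw [Matrix.mul_assoc, Matrix.trace_mul_comm, Matrix.mul_assoc, Matrix.trace_mul_comm]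
  rw [heq] at hlow
  simp_rw [hRt] at hlow
  have hRR : 0 ≤ ∑ x, (R x * R x).trace := Finset.sum_nonneg fun x _ => by
    have := trace_transpose_mul_self (R x)
    rw [hRt] at this
    rw [this]
    positivity
  have hexp : ∑ x, (R x * R x * (F x + η • 1)).trace =
      ∑ x, (R x * R x * F x).trace + η * ∑ x, (R x * R x).trace := by
    rw [Finset.mul_sum, ← Finset.sum_add_distrib]
    refine Finset.sum_congr rfl fun x _ => ?_
    rw [Matrix.mul_add, Matrix.trace_add, Matrix.mul_smul (R x * R x) η, Matrix.mul_one,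
      Matrix.trace_smul, smul_eq_mul]
  rw [hexp] at hup
  have h1 : B * (θ + (1 / θ + 1) * (τ * (((n * T : ℕ) : ℝ) / q) ^ (h + 1))) *
      (M * ∑ x, (R x * R x).trace) ≤ η * (M * ∑ x, (R x * R x).trace) :=
    mul_le_mul_of_nonneg_right hl (mul_nonneg hM0.le hRR)
  have h2 : 0 ≤ M * (∑ x, (R x * R x * F x).trace + η * ∑ x, (R x * R x).trace) := by
    linarith
  have h3 := mul_neg_of_pos_of_neg hM0 hup
  linarith

/-- A bounded pseudo-density planted along random graphs obstructs small factorizations. -/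
theorem not_factorization {n q r h T : ℕ} (hq : 0 < q) (hr : 0 < r) {D : Cube n → ℝ}
    {B κ θ η : ℝ} (hDB : ∀ y, |D y| ≤ B)
    (hD : ∀ g ∈ lowDegree (Fin n) h, 0 ≤ ∑ y, D y * g y ^ 2)
    (P : (Fin n → Fin q) → Matrix (Fin r) (Fin r) ℝ)
    (Q : (Fin n × Fin q → Bool) → Matrix (Fin r) (Fin r) ℝ)
    (hP : ∀ S, (P S).PosSemidef) (hQ : ∀ x, (Q x).PosSemidef)
    (hPQ : ∀ S x, frobInner (P S) (Q x) ≤ 2) (hθ : 0 < θ) (hη : 0 < η)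
    (hneg : ∑ x, ∑ S, D (alongGraph S x) * frobInner (P S) (Q x) ≤
      -(18 * η) * (q : ℝ) ^ n * 2 ^ (n * q))
    (hκ : 0 < κ) (hBκ : B ≤ 3 * η * κ)
    (hT : r * (B + η) ^ (2 * T + 1) < 2 * η * (B + 2 * η) ^ (2 * T))
    (hl : B * (θ + (1 / θ + 1) * (r * κ * (((n * T : ℕ) : ℝ) / q) ^ (h + 1))) ≤ η) : False := by
  have : Nonempty (Fin n → Fin q) := ⟨fun _ => ⟨0, hq⟩⟩
  obtain ⟨P', Q', hP', hQ', hPQ', hsum, hQt⟩ := exists_normalized_factorization P Q hP hQ hPQ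
  have hcardσ : (Fintype.card (Fin n → Fin q) : ℝ) = (q : ℝ) ^ n := by simp
  rw [hcardσ] at hsum
  obtain ⟨P'', bad, hP'', hτ, hbad, hgood, hsum', hcard⟩ :=
    exists_truncated_factors hr P' hP' hsum hκ
  have hB : 0 ≤ B := (abs_nonneg _).trans (hDB fun _ => false)
  refine not_normalized_factorization hq hDB hD P'' Q' hP'' hQ' hsum' hτ
    (fun x => (hQt x).trans (by norm_num)) hθ hη ?_ hT hl
  have h1 : ∀ x, ∑ S, D (alongGraph S x) * frobInner (P'' S) (Q' x) ≤
      ∑ S, D (alongGraph S x) * frobInner (P S) (Q x) + 6 * η * (q : ℝ) ^ n := by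
    intro x
    classical
    -- Zeroing a bad factor changes its term by at most 2B ≤ 6ηκ, and there are at most q^n/κ bad
    -- ones. The loss 6η turns 18η into 12η.
    have h2 : ∀ S, D (alongGraph S x) * frobInner (P'' S) (Q' x) ≤
        D (alongGraph S x) * frobInner (P S) (Q x) + if S ∈ bad then 2 * B else 0 := by
      intro S
      split_ifs with hS
      · rw [hbad S hS]
        have h0 : frobInner (0 : Matrix (Fin r) (Fin r) ℝ) (Q' x) = 0 := by simp [frobInner]
        rw [h0, mul_zero]
        have h3 := frobInner_nonneg (hP S) (hQ x)
        have h4 := hPQ S x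
        have h5 := (abs_le.mp (hDB (alongGraph S x))).1
        nlinarith
      · rw [hgood S hS, hPQ', add_zero]
    refine (Finset.sum_le_sum fun S _ => h2 S).trans ?_
    rw [Finset.sum_add_distrib]
    have h6 : ∑ S, (if S ∈ bad then 2 * B else 0) = bad.card * (2 * B) := by
      rw [Finset.sum_ite_mem, Finset.univ_inter, Finset.sum_const, nsmul_eq_mul]
    rw [h6]
    have h7 : (bad.card : ℝ) * (2 * B) ≤ bad.card * (2 * (3 * η * κ)) := by gcongr
    have h8 : 6 * η * (bad.card * κ) ≤ 6 * η * (q : ℝ) ^ n := by gcongr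
    linarith
  calc _ ≤ ∑ x, (∑ S, D (alongGraph S x) * frobInner (P S) (Q x) + 6 * η * (q : ℝ) ^ n) :=
        Finset.sum_le_sum fun x _ => h1 x
    _ = ∑ x, ∑ S, D (alongGraph S x) * frobInner (P S) (Q x) +
        6 * η * (q : ℝ) ^ n * 2 ^ (n * q) := by
        rw [Finset.sum_add_distrib, Finset.sum_const, Finset.card_univ, nsmul_eq_mul]
        simp
        ring
    _ ≤ _ := by linarith

/-! ### From relaxations to factorizations -/

/-- Rename the variables of an instance along an embedding. -/
def CSPInstance.rename {k n N : ℕ} {P : BoolCSP k} (I : CSPInstance P n) (e : Fin n ↪ Fin N) :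
    CSPInstance P N where
  size := I.size
  size_pos := I.size_pos
  constraint j := ⟨(I.constraint j).pred, (I.constraint j).pred_mem, (I.constraint j).vars.trans e⟩

theorem CSPInstance.value_rename {k n N : ℕ} {P : BoolCSP k} (I : CSPInstance P n)
    (e : Fin n ↪ Fin N) (x : Cube N) : (I.rename e).value x = I.value (fun i => x (e i)) :=
  rfl

theorem CSPInstance.value_le_opt {k n : ℕ} {P : BoolCSP k} (I : CSPInstance P n) (x : Cube n) :
    I.value x ≤ I.opt :=
  Finset.le_sup' I.value (Finset.mem_univ x)

theorem CSPInstance.opt_rename_le {k n N : ℕ} {P : BoolCSP k} (I : CSPInstance P n)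
    (e : Fin n ↪ Fin N) : (I.rename e).opt ≤ I.opt :=
  Finset.sup'_le _ _ fun x _ => by
    rw [I.value_rename e]
    exact I.value_le_opt _

theorem CSPInstance.value_nonneg {k n : ℕ} {P : BoolCSP k} (I : CSPInstance P n) (x : Cube n) :
    0 ≤ I.value x := by
  refine mul_nonneg (by positivity) (Finset.sum_nonneg fun j _ => ?_)
  rw [CSPConstraint.value, bitVal]
  split_ifs <;> norm_num

theorem sum_alongGraph {n q : ℕ} (S : Fin n → Fin q) (φ : Cube n → ℝ) :
    2 ^ n * ∑ x, φ (alongGraph S x) = 2 ^ (n * q) * ∑ y, φ y := by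
  rw [← sum_plant S (fun x => φ (alongGraph S x))]
  simp [alongGraph_plant]

/-- A pseudo-density for an instance on `n` variables rules out relaxations on the variables
`Fin n × Fin q`. -/
theorem not_achieves_of_pseudoDensity {k n q N r h T : ℕ} {P : BoolCSP k} (hq : 0 < q)
    (hr : 0 < r) (enc : Fin n × Fin q ↪ Fin N) (R : SDPRelaxation P N r) {c s ε : ℝ}
    (I : CSPInstance P n) (hI : I.opt ≤ s) (hε : 0 < ε) (hc : c ≤ 1) {D : Cube n → ℝ}
    {B κ θ η : ℝ} (hB : 0 < B) (hDB : ∀ y, |D y| ≤ B)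
    (hD : ∀ g ∈ lowDegree (Fin n) h, 0 ≤ ∑ y, D y * g y ^ 2)
    (hD1 : ∑ y, D y = 2 ^ n) (hDI : ∑ y, D y * (c + ε - I.value y) ≤ 0)
    (hθ : 0 < θ) (hη : 0 < η) (hηε : 24 * η ≤ ε) (hκ : 0 < κ) (hBκ : B ≤ 3 * η * κ)
    (hT : r * (B + η) ^ (2 * T + 1) < 2 * η * (B + 2 * η) ^ (2 * T))
    (hl : B * (θ + (1 / θ + 1) * (r * κ * (((n * T : ℕ) : ℝ) / q) ^ (h + 1))) ≤ η) :
    ¬ R.Achieves c s := by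
  intro hR
  -- The graph of S has one point per block, so the planted variables are distinct. Variables
  -- outside the n·q blocks are set to false by `ext`.
  let e : (Fin n → Fin q) → (Fin n ↪ Fin N) := fun S =>
    ⟨fun i => enc (i, S i), fun i j hij => (Prod.ext_iff.mp (enc.injective hij)).1⟩
  let ext : (Fin n × Fin q → Bool) → Cube N := fun x => Function.extend enc x fun _ => false
  have hval : ∀ S x, (I.rename (e S)).value (ext x) = I.value (alongGraph S x) := by
    intro S x
    rw [CSPInstance.value_rename]
    congr 1
    ext i
    exact enc.injective.extend_apply x _ (i, S i)
  -- The duality error is at most 1, so that entries stay below c + 1 ≤ 2, and costs at most ε/4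
  -- after weighting by D.
  set δ : ℝ := min 1 (ε / (4 * B)) with hδ
  have hδ0 : 0 < δ := lt_min one_pos (by positivity)
  have hBδ : B * δ ≤ ε / 4 := by
    calc B * δ ≤ B * (ε / (4 * B)) := mul_le_mul_of_nonneg_left (min_le_right _ _) hB.le
      _ = ε / 4 := by field_simp
  choose M hM l hl0 hMl using fun S => R.exists_certificate (I.rename (e S))
    (hR _ ((I.opt_rename_le (e S)).trans hI)) hδ0
  have hfrob : ∀ S x, |c - I.value (alongGraph S x) -
      (frobInner (M S) (R.linAssignment (ext x)) + l S)| ≤ δ := fun S x => by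
    rw [← hval]
    exact hMl S (ext x)
  refine not_factorization hq hr hDB hD M (fun x => R.linAssignment (ext x)) hM
    (fun x => R.posSemidef_assignment _) (fun S x => ?_) hθ hη ?_ hκ hBκ hT hl
  · have h1 := (abs_le.mp (hfrob S x)).1
    have h2 := I.value_nonneg (alongGraph S x)
    have h3 : δ ≤ 1 := min_le_left _ _
    linarith [hl0 S]
  · have h2n : (0 : ℝ) < 2 ^ n := by positivity
    have hS : ∀ S : Fin n → Fin q,
        ∑ x, D (alongGraph S x) * frobInner (M S) (R.linAssignment (ext x)) ≤
        -(18 * η) * 2 ^ (n * q) := by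
      intro S
      have h1 : ∀ x, D (alongGraph S x) * frobInner (M S) (R.linAssignment (ext x)) ≤
          D (alongGraph S x) * (c - I.value (alongGraph S x) - l S) + ε / 4 := by
        intro x
        have h2 : |D (alongGraph S x) * (c - I.value (alongGraph S x) -
            (frobInner (M S) (R.linAssignment (ext x)) + l S))| ≤ B * δ := by
          rw [abs_mul]
          exact mul_le_mul (hDB _) (hfrob S x) (abs_nonneg _) hB.le
        have h3 := (abs_le.mp h2).1
        linarith
      refine (Finset.sum_le_sum fun x _ => h1 x).trans ?_
      have h4 := sum_alongGraph S (fun y => D y * (c - I.value y - l S))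
      have h5 : ∑ y, D y * (c - I.value y - l S) ≤ -ε * 2 ^ n := by
        -- The constant l_S ≥ 0 can be dropped because D has positive mean. The remaining -ε + ε/4
        -- is at most -18η, as 24η ≤ ε.
        have h6 : ∑ y, D y * (c - I.value y - l S) =
            ∑ y, D y * (c + ε - I.value y) - (ε + l S) * ∑ y, D y := by
          rw [Finset.mul_sum, ← Finset.sum_sub_distrib]
          exact Finset.sum_congr rfl fun y _ => by ring
        rw [h6, hD1]
        nlinarith [hl0 S]
      have h7 : (∑ x, D (alongGraph S x) * (c - I.value (alongGraph S x) - l S)) ≤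
          -ε * 2 ^ (n * q) := by
        refine le_of_mul_le_mul_left ?_ h2n
        rw [h4]
        have h8 : (0 : ℝ) < 2 ^ (n * q) := by positivity
        nlinarith
      rw [Finset.sum_add_distrib, Finset.sum_const, Finset.card_univ, nsmul_eq_mul]
      have hcard : (Fintype.card (Fin n × Fin q → Bool) : ℝ) = 2 ^ (n * q) := by simp
      rw [hcard]
      have h8 : (0 : ℝ) < 2 ^ (n * q) := by positivity
      nlinarith
    rw [Finset.sum_comm]
    calc _ ≤ ∑ _S : Fin n → Fin q, -(18 * η) * (2 : ℝ) ^ (n * q) :=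
          Finset.sum_le_sum fun S _ => hS S
      _ = _ := by
          rw [Finset.sum_const, Finset.card_univ, nsmul_eq_mul]
          simp
          ring

/-! ### Numerical estimates for the parameters -/

/-- The spectral condition with η = 1/a and T = 2aBL. The ratio of B + 2η to B + η is at least 1 +
1/(2aB), whose power 2aB is at least 2 by Bernoulli; raised to 2T the ratio gains 4^L. -/
theorem mul_pow_succ_lt_of_lt_four_pow {r B a L : ℕ} (hB : 1 ≤ B) (ha : 1 ≤ a)
    (h : r * B * a < 4 ^ L) :
    (r : ℝ) * ((B : ℝ) + 1 / a) ^ (2 * (2 * a * B * L) + 1) <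
      2 * (1 / a) * ((B : ℝ) + 2 * (1 / a)) ^ (2 * (2 * a * B * L)) := by
  have ha' : (1 : ℝ) ≤ a := by exact_mod_cast ha
  have hB' : (1 : ℝ) ≤ B := by exact_mod_cast hB
  have hη1 : (1 : ℝ) / a ≤ 1 := by
    rw [div_le_one (by linarith)]
    exact ha'
  have hη0 : (0 : ℝ) < 1 / a := by positivity
  set η : ℝ := 1 / a with hη
  have hstep : ((B : ℝ) + η) * (1 + 1 / (2 * a * B)) ≤ B + 2 * η := by
    have h1 : ((B : ℝ) + η) * (1 / (2 * a * B)) ≤ (2 * B) * (1 / (2 * a * B)) :=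
      mul_le_mul_of_nonneg_right (by linarith) (by positivity)
    have h2 : (2 * (B : ℝ)) * (1 / (2 * a * B)) = η := by
      rw [hη]
      field_simp
    linarith
  have hbern : (2 : ℝ) ≤ (1 + 1 / (2 * a * B)) ^ (2 * a * B) := by
    have h1 := one_add_mul_le_pow (a := (1 : ℝ) / (2 * a * B))
      (le_trans (by norm_num) (by positivity : (0 : ℝ) ≤ 1 / (2 * a * B))) (2 * a * B)
    have h2 : ((2 * a * B : ℕ) : ℝ) * (1 / (2 * a * B)) = 1 := by
      push_cast
      field_simp
    linarith
  have hpow : ((B : ℝ) + η) ^ (2 * (2 * a * B * L)) * 4 ^ L ≤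
      (B + 2 * η) ^ (2 * (2 * a * B * L)) := by
    have h1 : (4 : ℝ) ^ L ≤ (1 + 1 / (2 * a * B)) ^ (2 * (2 * a * B * L)) := by
      have h2 : (1 + 1 / (2 * (a : ℝ) * B)) ^ (2 * (2 * a * B * L)) =
          (((1 + 1 / (2 * (a : ℝ) * B)) ^ (2 * a * B)) ^ 2) ^ L := by
        rw [← pow_mul, ← pow_mul]
        congr 1
        ring
      rw [h2]
      refine pow_le_pow_left₀ (by norm_num) ?_ _
      calc (4 : ℝ) = 2 ^ 2 := by norm_num
        _ ≤ _ := pow_le_pow_left₀ (by norm_num) hbern _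
    calc _ ≤ ((B : ℝ) + η) ^ (2 * (2 * a * B * L)) *
          (1 + 1 / (2 * a * B)) ^ (2 * (2 * a * B * L)) :=
          mul_le_mul_of_nonneg_left h1 (by positivity)
      _ = (((B : ℝ) + η) * (1 + 1 / (2 * a * B))) ^ (2 * (2 * a * B * L)) := by rw [mul_pow]
      _ ≤ _ := pow_le_pow_left₀ (by positivity) hstep _
  have hr : (r : ℝ) * (B + η) < 2 * η * 4 ^ L := by
    have h1 : (r : ℝ) * B * a < 4 ^ L := by exact_mod_cast h
    have h2 : (r : ℝ) * (B + η) ≤ r * (2 * B) :=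
      mul_le_mul_of_nonneg_left (by linarith) (Nat.cast_nonneg _)
    have h3 : (r : ℝ) * (2 * B) = 2 * η * (r * B * a) := by
      rw [hη]
      field_simp
    have h4 := mul_lt_mul_of_pos_left h1 (by positivity : (0 : ℝ) < 2 * η)
    linarith
  calc (r : ℝ) * (B + η) ^ (2 * (2 * a * B * L) + 1)
      = (r * (B + η)) * (B + η) ^ (2 * (2 * a * B * L)) := by ring
    _ < (2 * η * 4 ^ L) * (B + η) ^ (2 * (2 * a * B * L)) :=
        mul_lt_mul_of_pos_right hr (by positivity)
    _ = 2 * η * ((B + η) ^ (2 * (2 * a * B * L)) * 4 ^ L) := by ring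
    _ ≤ _ := mul_le_mul_of_nonneg_left hpow (by positivity)

/-- With θ = η/(2B), each of the two error terms takes half of the budget η = 1/a; κ is aB. -/
theorem error_term_le {r B a m : ℕ} {ρ : ℝ} (hB : 1 ≤ B) (ha : 1 ≤ a) (hρ : 0 ≤ ρ)
    (h : (6 * a ^ 3 * B ^ 3 * r : ℕ) * ρ ^ m ≤ 1) :
    (B : ℝ) * (1 / a / (2 * B) + (1 / (1 / a / (2 * B)) + 1) * (r * (a * B) * ρ ^ m)) ≤
      1 / a := by
  have ha' : (1 : ℝ) ≤ a := by exact_mod_cast ha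
  have hB' : (1 : ℝ) ≤ B := by exact_mod_cast hB
  have h1 : (1 : ℝ) / (1 / a / (2 * B)) = 2 * a * B := by
    field_simp
  have haB : (1 : ℝ) ≤ a * B := one_le_mul_of_one_le_of_one_le ha' hB'
  have h2 : (B : ℝ) * ((2 * a * B + 1) * (r * (a * B) * ρ ^ m)) ≤
      B * ((3 * a * B) * (r * (a * B) * ρ ^ m)) := by
    have : (2 * (a : ℝ) * B + 1) ≤ 3 * a * B := by linarith
    gcongr
  have h3 : (B : ℝ) * ((3 * a * B) * (r * (a * B) * ρ ^ m)) ≤ 1 / a / 2 := by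
    rw [div_div, le_div_iff₀ (by positivity)]
    push_cast at h
    calc _ = 6 * (a : ℝ) ^ 3 * B ^ 3 * r * ρ ^ m := by ring
      _ ≤ 1 := h
  have h4 : (B : ℝ) * (1 / a / (2 * B)) = 1 / a / 2 := by
    field_simp
  rw [mul_add, h1, h4]
  linarith

theorem succ_pow_le_pow {n d : ℕ} (hn : 2 ≤ n) : (n + 1) ^ d ≤ n ^ (2 * d) := by
  rw [pow_mul]
  exact Nat.pow_le_pow_left (by nlinarith) d

theorem mul_lt_four_pow {n d r a : ℕ} (hn : 2 ≤ n) (hd : 40 ≤ d) (ha : a ≤ n)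
    (hr : r ≤ n ^ (d * d / 8 + 1)) : r * (n + 1) ^ d * a < 4 ^ (n * d ^ 2) := by
  have hexp : d * d / 8 + 1 + 2 * d + 1 ≤ 2 * d ^ 2 := by
    have h1 : d * d / 8 ≤ d * d := Nat.div_le_self _ _
    nlinarith
  calc r * (n + 1) ^ d * a ≤ n ^ (d * d / 8 + 1) * n ^ (2 * d) * n :=
        Nat.mul_le_mul (Nat.mul_le_mul hr (succ_pow_le_pow hn)) ha
    _ = n ^ (d * d / 8 + 1 + 2 * d + 1) := by rw [← pow_add, ← pow_succ]
    _ ≤ n ^ (2 * d ^ 2) := Nat.pow_le_pow_right (by omega) hexp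
    _ < (2 ^ n) ^ (2 * d ^ 2) :=
        Nat.pow_lt_pow_left Nat.lt_two_pow_self (by positivity)
    _ = 4 ^ (n * d ^ 2) := by
        rw [← pow_mul, show (4 : ℕ) = 2 ^ 2 by norm_num, ← pow_mul]
        congr 1
        ring

/-- The degree nT is at most n^(3d+3), so dividing by q = n^(4d-1) leaves at most n^(-(d-4)). -/
theorem degree_mul_le {n d a : ℕ} (hn : 6 ≤ n) (hd : 40 ≤ d) (ha : 2 * a ≤ n) :
    n * (2 * a * (n + 1) ^ d * (n * d ^ 2)) * n ^ (d - 4) ≤ n ^ (4 * d - 1) := by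
  have hd2 : d ^ 2 ≤ n ^ d := by
    calc d ^ 2 ≤ (2 ^ d) ^ 2 := Nat.pow_le_pow_left Nat.lt_two_pow_self.le 2
      _ = 4 ^ d := by
        rw [← pow_mul, mul_comm, pow_mul]
        norm_num
      _ ≤ n ^ d := Nat.pow_le_pow_left (by omega) d
  have hB : (n + 1) ^ d ≤ n ^ (2 * d) := succ_pow_le_pow (by omega)
  calc n * (2 * a * (n + 1) ^ d * (n * d ^ 2)) * n ^ (d - 4)
      ≤ n * (n * n ^ (2 * d) * (n * n ^ d)) * n ^ (d - 4) := by
        gcongr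
    _ = n ^ (3 + 2 * d + d + (d - 4)) := by
        rw [pow_add, pow_add, pow_add]
        ring
    _ = n ^ (4 * d - 1) := by
        congr 1
        omega

/-- The comparison that permits the exponent d²/8: the left side costs 6d + 5 + d²/8 in the
exponent, against roughly d²/2 on the right. -/
theorem const_mul_le_pow {n d r a : ℕ} (hn : 6 ≤ n) (hd : 40 ≤ d) (ha : a ≤ n)
    (hr : r ≤ n ^ (d * d / 8 + 1)) :
    6 * a ^ 3 * ((n + 1) ^ d) ^ 3 * r ≤ (n ^ (d - 4)) ^ (d / 2 + 1) := by
  have hexp : 4 + 6 * d + (d * d / 8 + 1) ≤ (d - 4) * (d / 2 + 1) := by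
    obtain ⟨u, rfl⟩ : ∃ u, d = u + 4 := ⟨d - 4, by omega⟩
    have h1 : 8 * ((u + 4) * (u + 4) / 8) ≤ (u + 4) * (u + 4) := Nat.mul_div_le _ _
    have h2 : u + 5 ≤ 2 * ((u + 4) / 2 + 1) := by omega
    have h3 : u * (u + 5) ≤ u * (2 * ((u + 4) / 2 + 1)) := Nat.mul_le_mul_left u h2
    rw [Nat.add_sub_cancel]
    nlinarith
  have hB : (n + 1) ^ d ≤ n ^ (2 * d) := succ_pow_le_pow (by omega)
  calc 6 * a ^ 3 * ((n + 1) ^ d) ^ 3 * r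
      ≤ n * n ^ 3 * (n ^ (2 * d)) ^ 3 * n ^ (d * d / 8 + 1) := by
        gcongr
    _ = n ^ (4 + 6 * d + (d * d / 8 + 1)) := by
        rw [pow_add, pow_add, ← pow_mul]
        ring
    _ ≤ n ^ ((d - 4) * (d / 2 + 1)) := Nat.pow_le_pow_right (by omega) hexp
    _ = _ := by rw [pow_mul]

theorem error_power_le_one {n d r a : ℕ} (hn : 6 ≤ n) (hd : 40 ≤ d) (ha : 2 * a ≤ n)
    (hr : r ≤ n ^ (d * d / 8 + 1)) :
    ((6 * a ^ 3 * ((n + 1) ^ d) ^ 3 * r : ℕ) : ℝ) *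
      (((n * (2 * a * (n + 1) ^ d * (n * d ^ 2)) : ℕ) : ℝ) / ((n ^ (4 * d - 1) : ℕ) : ℝ)) ^
        (d / 2 + 1) ≤ 1 := by
  have hn0 : (0 : ℝ) < n := by
    have : 0 < n := by omega
    exact_mod_cast this
  have h1 : ((n * (2 * a * (n + 1) ^ d * (n * d ^ 2)) : ℕ) : ℝ) / ((n ^ (4 * d - 1) : ℕ) : ℝ) ≤
      1 / ((n ^ (d - 4) : ℕ) : ℝ) := by
    rw [div_le_div_iff₀ (by push_cast; positivity) (by push_cast; positivity), one_mul]
    exact_mod_cast degree_mul_le hn hd ha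
  have h2 : ((6 * a ^ 3 * ((n + 1) ^ d) ^ 3 * r : ℕ) : ℝ) ≤
      (((n ^ (d - 4) : ℕ) : ℝ)) ^ (d / 2 + 1) := by
    exact_mod_cast const_mul_le_pow hn hd (by omega) hr
  calc _ ≤ (((n ^ (d - 4) : ℕ) : ℝ)) ^ (d / 2 + 1) * (1 / ((n ^ (d - 4) : ℕ) : ℝ)) ^ (d / 2 + 1) :=
        mul_le_mul h2 (pow_le_pow_left₀ (by positivity) h1 _) (by positivity) (by positivity)
    _ = 1 := by
        rw [← mul_pow, mul_one_div_cancel, one_pow]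
        push_cast
        positivity

/-! ### Choice of parameters and conclusion -/

/-- The lower bound for large `n`. -/
theorem not_achieves_of_large {k n N r d a : ℕ} {P : BoolCSP k} {c s ε : ℝ} (hε : 0 < ε)
    (hc : c ≤ 1) (hk : k ≤ 2 * (d / 2)) (hn : 6 ≤ n) (hd : 40 ≤ d) (ha1 : 1 ≤ a)
    (ha : 2 * a ≤ n) (haε : 24 * (1 / (a : ℝ)) ≤ ε) (hr0 : 0 < r)
    (hr : r ≤ n ^ (d * d / 8 + 1)) (hN : n ^ (4 * d) < N)
    (hsos : ¬ SosAchieves P n d (c + ε) s) (R : SDPRelaxation P N r) : ¬ R.Achieves c s := by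
  obtain ⟨I, hI, hIv⟩ : ∃ I : CSPInstance P n, I.opt ≤ s ∧
      ¬ sosBound d I.value ≤ ((c + ε : ℝ) : EReal) := by
    simpa [SosAchieves] using hsos
  obtain ⟨D, hDB, hD, hD1, hDI⟩ :=
    exists_pseudoDensity (lowDegree_mono hk I.value_mem_lowDegree) hIv
  have hcard : Fintype.card (Fin n × Fin (n ^ (4 * d - 1))) ≤ Fintype.card (Fin N) := by
    rw [Fintype.card_prod, Fintype.card_fin, Fintype.card_fin, Fintype.card_fin, ← pow_succ',
      show 4 * d - 1 + 1 = 4 * d by omega]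
    exact hN.le
  obtain ⟨enc⟩ := Function.Embedding.nonempty_of_card_le hcard
  have hB1 : 1 ≤ (n + 1) ^ d := Nat.one_le_pow _ _ (by omega)
  have ha0 : (0 : ℝ) < a := by exact_mod_cast ha1
  have hB0 : (0 : ℝ) < (((n + 1) ^ d : ℕ) : ℝ) := by exact_mod_cast hB1
  -- The block size makes n·q = n^(4d) < N. In T the factor L = n d² ensures that 4^L exceeds r B a.
  refine not_achieves_of_pseudoDensity (q := n ^ (4 * d - 1)) (h := d / 2)
    (T := 2 * a * (n + 1) ^ d * (n * d ^ 2)) (B := (((n + 1) ^ d : ℕ) : ℝ))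
    (κ := a * (((n + 1) ^ d : ℕ) : ℝ)) (θ := 1 / a / (2 * (((n + 1) ^ d : ℕ) : ℝ)))
    (η := 1 / (a : ℝ)) (Nat.pow_pos (by omega)) hr0 enc R I hI hε hc hB0
    (fun y => by simpa using hDB y) hD hD1 hDI (by positivity) (by positivity) haε
    (by positivity) ?_ ?_ ?_
  · have : 3 * (1 / (a : ℝ)) * (a * (((n + 1) ^ d : ℕ) : ℝ)) = 3 * (((n + 1) ^ d : ℕ) : ℝ) := by
      field_simp
    rw [this]
    linarith
  · exact mul_pow_succ_lt_of_lt_four_pow hB1 ha1 (mul_lt_four_pow (by omega) hd (by omega) hr)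
  · exact error_term_le hB1 ha1 (by positivity) (error_power_le_one hn hd ha hr)

/-- If a relaxation of size zero exists, then no constraint is satisfiable. -/
theorem sosAchieves_of_relaxation_size_zero {k n N d : ℕ} {P : BoolCSP k} {v s : ℝ} (hv : 0 ≤ v)
    (hkN : k ≤ n → k ≤ N) (R : SDPRelaxation P N 0) : SosAchieves P n d v s := by
  intro I _
  have hzero : ∀ (J : CSPInstance P N) (x : Cube N), J.value x = 0 := by
    intro J x
    rw [← R.inner_eq]
    simp [frobInner, Matrix.trace]
  have hpred : ∀ (C : CSPConstraint P n) (y : Cube k), C.pred y = false := by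
    intro C y
    have hk : k ≤ N := hkN (by simpa using Fintype.card_le_of_embedding C.vars)
    -- A one-constraint instance with the same predicate; matrices of size 0 force its value to
    -- vanish everywhere.
    let J : CSPInstance P N := ⟨1, one_pos, fun _ => ⟨C.pred, C.pred_mem, Fin.castLEEmb hk⟩⟩
    have h := hzero J (Function.extend (Fin.castLEEmb hk) y fun _ => false)
    have h2 : (fun j => Function.extend (Fin.castLEEmb hk) y (fun _ => false)
        (Fin.castLEEmb hk j)) = y :=
      funext fun j => (Fin.castLEEmb hk).injective.extend_apply y _ j
    simp only [CSPInstance.value, J, CSPConstraint.value, h2] at h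
    cases hy : C.pred y
    · rfl
    · simp [hy, bitVal] at h
  refine sosBound_le ?_
  have hI : (fun x => v - I.value x) = fun _ => v := by
    ext x
    simp [CSPInstance.value, CSPConstraint.value, hpred, bitVal]
  rw [hI]
  exact isCubeSOS_const d hv

theorem mainTheorem12 (k : ℕ) (P : BoolCSP k) (d : ℕ → ℕ)
    (hmono : MonotoneOn d (Set.Ici 1))
    (hd1 : 2 * ⌈(k : ℝ) / 2⌉₊ ≤ d 1)
    (hlim : Filter.Tendsto d Filter.atTop Filter.atTop)
    (ε s c : ℝ) (hε : 0 < ε) (hs : 0 < s) (hsc : s < c) (hc : c ≤ 1) :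
    ∃ K : ℝ, 0 < K ∧
      ∀ n : ℕ, 1 ≤ n → ¬ SosAchieves P n (d n) (c + ε) s →
        ∀ N : ℕ, n ^ (4 * d n) < N →
          ∀ r : ℕ, (r : ℝ) ≤ K * (n : ℝ) ^ ((d n : ℝ) ^ 2 / 8) →
            ∀ R : SDPRelaxation P N r, ¬ R.Achieves c s := by
  obtain ⟨n₁, hn₁⟩ := Filter.eventually_atTop.mp (hlim.eventually_ge_atTop 40)
  set a : ℕ := max 1 ⌈24 / ε⌉₊ with ha
  have ha1 : 1 ≤ a := le_max_left _ _
  have haε : 24 * (1 / (a : ℝ)) ≤ ε := by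
    have h1 : 24 / ε ≤ a := (Nat.le_ceil _).trans (by exact_mod_cast le_max_right _ _)
    have h2 : (0 : ℝ) < a := by exact_mod_cast ha1
    rw [mul_one_div, div_le_iff₀ h2]
    rwa [div_le_iff₀ hε, mul_comm] at h1
  set n₀ : ℕ := max n₁ (max 6 (2 * a)) with hn₀
  set W : ℝ := ∑ n ∈ Finset.range n₀, (n : ℝ) ^ ((d n : ℝ) ^ 2 / 8) with hW
  have hterm : ∀ n : ℕ, 0 ≤ (n : ℝ) ^ ((d n : ℝ) ^ 2 / 8) := fun n => by positivity
  have hW_nonneg : 0 ≤ W := Finset.sum_nonneg fun n _ => hterm n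
  -- W dominates n^(d(n)²/8) for every n < n₀, so for those n the size bound is below 1 and only r =
  -- 0 is left, which is excluded separately.
  refine ⟨1 / (1 + W), by positivity, fun n hn hsos N hN r hr R => ?_⟩
  have hkd : k ≤ 2 * (d n / 2) := by
    have h1 : d 1 ≤ d n := hmono (Set.mem_Ici.mpr le_rfl) (Set.mem_Ici.mpr hn) hn
    have h2 : (k : ℝ) ≤ 2 * ⌈(k : ℝ) / 2⌉₊ := by linarith [Nat.le_ceil ((k : ℝ) / 2)]
    have h3 : k ≤ 2 * ⌈(k : ℝ) / 2⌉₊ := by exact_mod_cast h2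
    omega
  have hr0 : 0 < r := by
    rcases Nat.eq_zero_or_pos r with rfl | h
    · refine absurd (sosAchieves_of_relaxation_size_zero (by linarith) (fun hkn => ?_) R) hsos
      rcases Nat.eq_zero_or_pos k with rfl | hk
      · exact Nat.zero_le _
      · have h1 : n ≤ n ^ (4 * d n) := Nat.le_self_pow (by omega) n
        omega
    · exact h
  by_cases hlarge : n₀ ≤ n
  · have hnn₁ : n₁ ≤ n := (le_max_left _ _).trans hlarge
    have hn6 : 6 ≤ n := (le_max_left _ _).trans ((le_max_right _ _).trans hlarge)
    have hn2a : 2 * a ≤ n := (le_max_right _ _).trans ((le_max_right _ _).trans hlarge)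
    have hn1 : (1 : ℝ) ≤ n := by exact_mod_cast hn
    refine not_achieves_of_large hε hc hkd hn6 (hn₁ n hnn₁) ha1 hn2a haε hr0 ?_ hN hsos R
    have h1 : (r : ℝ) ≤ (n : ℝ) ^ ((d n : ℝ) ^ 2 / 8) := by
      refine hr.trans (mul_le_of_le_one_left (hterm n) ?_)
      rw [div_le_one (by positivity)]
      linarith
    -- The real exponent is rounded up to an integer; the additional factor n is allowed for in the
    -- estimates.
    have h2 : (d n : ℝ) ^ 2 / 8 ≤ ((d n * d n / 8 + 1 : ℕ) : ℝ) := by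
      have h3 : d n * d n ≤ 8 * (d n * d n / 8 + 1) := by omega
      rw [div_le_iff₀ (by norm_num), sq, mul_comm _ (8 : ℝ)]
      exact_mod_cast h3
    have h4 := h1.trans (Real.rpow_le_rpow_of_exponent_le hn1 h2)
    rw [Real.rpow_natCast] at h4
    exact_mod_cast h4
  · exfalso
    have h1 : (n : ℝ) ^ ((d n : ℝ) ^ 2 / 8) ≤ W :=
      Finset.single_le_sum (f := fun n : ℕ => (n : ℝ) ^ ((d n : ℝ) ^ 2 / 8))
        (fun n _ => hterm n) (Finset.mem_range.mpr (not_le.mp hlarge))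
    have h2 : (1 : ℝ) ≤ r := by exact_mod_cast hr0
    rw [div_mul_eq_mul_div, one_mul, le_div_iff₀ (by positivity)] at hr
    nlinarith
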